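/- Let $\Omega\subset\mathbb{R}^2$ be a polygonal domain with a finite conforming triangular mesh $\mathcal{T}_h$, so that $\Omega$ is the interior of the union of the closed triangles $K\in\mathcal{T}_h$. For $K\in\mathcal{T}_h$ let $K_0$ be its interior, $\partial K$ its boundary, $\mathbf{n}$ the unit outward normal on $\partial K$, $|K|$ its area and $h_K$ its diameter; write $(\cdot,\cdot)_K$ for the $L^2(K)$ inner product, $(\cdot,\cdot)=\sum_K(\cdot,\cdot)_K$ and $\langle\cdot,\cdot\rangle_{\partial K}$ for the $L^2(\partial K)$ inner product. An edge is called a boundary edge if it lies on $\partial\Omega$. Let $\mathcal{A}(\mathbf{x})\in\mathbb{R}^{2\times2}$ be symmetric and uniformly positive definite for $\mathbf{x}\in\Omega$ and, for every $K$, Lipschitz continuous in the interior of $K$ with constant $L_{\mathcal{A},K}$: $$|\mathcal{A}(\mathbf{x})-\mathcal{A}(\mathbf{y})|\le L_{\mathcal{A},K}\,|\mathbf{x}-\mathbf{y}|\qquad\text{for all }\mathbf{x},\mathbf{y}\in K_0,$$ where $|\cdot|$ is the Euclidean norm on vectors and the matrix norm induced by it (so $\mathcal{A}$ may jump across edges).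 Put $$\lambda_{\min,K}(\mathcal{A})=\inf_{\mathbf{x}\in K_0}\lambda_{\min}(\mathcal{A}(\mathbf{x})),\qquad \mathcal{A}_K=\frac1{|K|}\int_K\mathcal{A}\,d\mathbf{x},$$ with $\lambda_{\min}$ the smallest eigenvalue. For a vertex $p$ of $K$ with the other two vertices $q,r$, let $\alpha_{p,\mathcal{A}_K^{-1}}$ denote the angle of $K$ at $p$ measured in the metric $\mathcal{A}_K^{-1}$, i.e. $$\cos\alpha_{p,\mathcal{A}_K^{-1}}=\frac{(q-p)^T\mathcal{A}_K^{-1}(r-p)}{\sqrt{(q-p)^T\mathcal{A}_K^{-1}(q-p)}\,\sqrt{(r-p)^T\mathcal{A}_K^{-1}(r-p)}}.$$ Let $V_h$ be the space of functions $v=\{v_0,v_b\}$ that consist of one constant $v_0|_{K_0}$ for the interior of each triangle $K$ and one constant $v_b|_e$ for each edge $e$. Let $RT_0(K)=\{\mathbf{a}+c\,\mathbf{x}:\mathbf{a}\in\mathbb{R}^2,\ c\in\mathbb{R}\}$. The weak gradient $\nabla_w v$ of $v\in V_h$ is defined on each $K$ by $\nabla_w v|_K\in RT_0(K)$ and $$(\nabla_w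 v,\mathbf{q})_K=-(v_0,\nabla\cdot\mathbf{q})_K+\langle v_b,\mathbf{q}\cdot\mathbf{n}\rangle_{\partial K}\qquad\text{for all }\mathbf{q}\in RT_0(K).$$ Given $f\in L^1(\Omega)$ and constants $g_h|_e$ on the boundary edges $e$, a weak Galerkin approximation is a function $u_h=\{u_0,u_b\}\in V_h$ with $u_b=g_h$ on the boundary edges and $$(\mathcal{A}\nabla_w u_h,\nabla_w v)=(f,v_0)\qquad\text{for all }v=\{v_0,v_b\}\in V_h\text{ with }v_b=0\text{ on the boundary edges}.$$ **Theorem.** Suppose that for every $K\in\mathcal{T}_h$ $$\frac{L_{\mathcal{A},K}^2h_K^2}{\lambda_{\min,K}(\mathcal{A})^2}\le\cos\alpha_{p,\mathcal{A}_K^{-1}}\quad\text{for each of the three vertices }p\text{ of }K,\qquad\text{and}\qquad \frac{h_K^3}{|K|}\le\frac{2\lambda_{\min,K}(\mathcal{A})}{3L_{\mathcal{A},K}},$$ where the last condition is void if $L_{\mathcal{A},K}=0$. Then every weak Galerkin approximation $u_h$ satisfies the discrete maximum principle: if $f(\mathbf{x})\le0$ for all $\mathbf{x}\in\Omega$, then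 $$u_h(\mathbf{x})\le\max\Bigl\{0,\ \max_{e\text{ boundary edge}}u_b|_e\Bigr\}\qquad\text{for all }\mathbf{x}\in\Omega\text{ that are not vertices of the mesh}.$$ -/

import Mathlib

open MeasureTheory Set
open scoped Matrix.Norms.L2Operator

noncomputable section

namespace WeakGalerkin

/-- The Euclidean plane. -/
abbrev Plane : Type := EuclideanSpace ℝ (Fin 2)

/-- The bilinear form `(u, v) ↦ uᵀ B v` of a `2 × 2` matrix. -/
def matForm (B : Matrix (Fin 2) (Fin 2) ℝ) (u v : Plane) : ℝ :=
  u.ofLp ⬝ᵥ (B.mulVec v.ofLp)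

/-- A (conforming) triangular mesh of the open set `Ω`: a finite simplicial complex in the plane, each
face of which lies in a triangle, and such that `Ω` is the interior of the union of the closed
triangles. A face is stored as the finite set of its vertices. -/
structure TriangularMesh (Ω : Set Plane) where
  complex : Geometry.SimplicialComplex ℝ Plane
  finite_faces : complex.faces.Finite
  pure : ∀ s ∈ complex.faces, ∃ K ∈ complex.faces, K.card = 3 ∧ s ⊆ K
  domain_eq : Ω = interior complex.space

variable {Ω : Set Plane}

namespace TriangularMesh

/-- The elements (triangles) of the mesh. -/
def Element (T : TriangularMesh Ω) : Type :=
  {s : Finset Plane // s ∈ T.complex.faces ∧ s.card = 3}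

/-- The edges of the mesh. -/
def Edge (T : TriangularMesh Ω) : Type :=
  {s : Finset Plane // s ∈ T.complex.faces ∧ s.card = 2}

instance (T : TriangularMesh Ω) : Fintype T.Element :=
  (T.finite_faces.subset (fun _ hs => hs.1 :
    {s : Finset Plane | s ∈ T.complex.faces ∧ s.card = 3} ⊆ T.complex.faces)).fintype

instance (T : TriangularMesh Ω) : Fintype T.Edge :=
  (T.finite_faces.subset (fun _ hs => hs.1 :
    {s : Finset Plane | s ∈ T.complex.faces ∧ s.card = 2} ⊆ T.complex.faces)).fintype

variable {T : TriangularMesh Ω}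

/-- The closed triangle. -/
def Element.closedCell (K : T.Element) : Set Plane := convexHull ℝ (K.1 : Set Plane)

/-- The interior `K₀` of the triangle `K`. -/
def Element.cell (K : T.Element) : Set Plane := interior K.closedCell

/-- The area `|K|`. -/
def Element.area (K : T.Element) : ℝ := volume.real K.cell

/-- The diameter `h_K`. -/
def Element.diam (K : T.Element) : ℝ := Metric.diam K.closedCell

/-- The closed segment. -/
def Edge.closedCell (e : T.Edge) : Set Plane := convexHull ℝ (e.1 : Set Plane)

/-- The segment without its two end points. -/
def Edge.cell (e : T.Edge) : Set Plane := e.closedCell \ (e.1 : Set Plane)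

/-- The boundary edges, that is, those that lie on `∂Ω`. -/
def Edge.IsBoundary (e : T.Edge) : Prop := e.closedCell ⊆ frontier Ω

open Classical in
/-- The edges of the element `K`. -/
def Element.edges (K : T.Element) : Finset T.Edge :=
  Finset.univ.filter fun e => e.1 ⊆ K.1

/-- The unit outward normal of the element `K` on its edge `e`: the normalized component orthogonal
to `e` of the vector from the centroid of `K` to the midpoint of `e`. -/
def outwardNormal (K : T.Element) (e : T.Edge) : Plane :=
  let d := (vectorSpan ℝ (e.1 : Set Plane))ᗮ.starProjection
    ((2 : ℝ)⁻¹ • ∑ x ∈ e.1, x - (3 : ℝ)⁻¹ • ∑ x ∈ K.1, x)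
  ‖d‖⁻¹ • d

end TriangularMesh

open TriangularMesh

/-- The lowest order Raviart-Thomas space: the vector fields `x ↦ a + c x` with `a ∈ ℝ²`, `c ∈ ℝ`
(as polynomial fields; they are used on one element at a time). -/
def RT0 : Submodule ℝ (Plane → Plane) where
  carrier := {q | ∃ (a : Plane) (c : ℝ), ∀ x, q x = a + c • x}
  add_mem' := by
    rintro p q ⟨a, c, h⟩ ⟨b, d, k⟩
    exact ⟨a + b, c + d, fun x => by rw [Pi.add_apply, h, k, add_smul]; abel⟩
  zero_mem' := ⟨0, 0, fun x => by simp⟩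
  smul_mem' := by
    rintro r q ⟨a, c, h⟩
    exact ⟨r • a, r * c, fun x => by rw [Pi.smul_apply, h, smul_add, smul_smul]⟩

/-- The divergence of a vector field. -/
def divergence (q : Plane → Plane) (x : Plane) : ℝ :=
  ∑ i : Fin 2, (fderiv ℝ q x (EuclideanSpace.single i 1)) i

/-- The weak discrete space `V_h`: one constant for the interior of each element and one constant for
each edge. -/
@[ext]
structure DiscreteFunction (T : TriangularMesh Ω) where
  elem : T.Element → ℝ
  edge : T.Edge → ℝ

/-- The value of a function of `V_h` at a point: the sum of the basis functions (the indicators of the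
open triangles and of the open edges) times their coefficients. No value is meant at the vertices of
the mesh. -/
def DiscreteFunction.toFun {T : TriangularMesh Ω} (u : DiscreteFunction T) (x : Plane) : ℝ :=
  ∑ K : T.Element, K.cell.indicator (fun _ => u.elem K) x +
    ∑ e : T.Edge, e.cell.indicator (fun _ => u.edge e) x

/-- `p` is the weak gradient of `v` on `K`: `p ∈ RT₀(K)` and
`(p, q)_K = -(v₀, ∇ ⬝ q)_K + ⟨v_b, q ⬝ n⟩_∂K` for all `q ∈ RT₀(K)`. The integral over `∂K` is taken
with respect to arc length (one-dimensional Hausdorff measure). -/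
def IsWeakGradient {T : TriangularMesh Ω} (v : DiscreteFunction T) (K : T.Element)
    (p : Plane → Plane) : Prop :=
  p ∈ RT0 ∧ ∀ q ∈ RT0, ∫ x in K.cell, inner ℝ (p x) (q x) =
    -(∫ x in K.cell, v.elem K * divergence q x) +
      ∑ e ∈ K.edges, ∫ x in e.closedCell,
        v.edge e * inner ℝ (q x) (outwardNormal K e) ∂(Measure.hausdorffMeasure 1 : Measure Plane)

section Existence

variable {T : TriangularMesh Ω}

lemma RT0.contDiff {q : Plane → Plane} (hq : q ∈ RT0) : ContDiff ℝ 1 q := by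
  obtain ⟨a, c, h⟩ := hq
  obtain rfl : q = fun x => a + c • x := funext h
  fun_prop

lemma divergence_add {p q : Plane → Plane} (hp : p ∈ RT0) (hq : q ∈ RT0) (x : Plane) :
    divergence (p + q) x = divergence p x + divergence q x := by
  have h1 := (RT0.contDiff hp).differentiable (by norm_num) x
  have h2 := (RT0.contDiff hq).differentiable (by norm_num) x
  simp only [divergence, fderiv_add h1 h2, ← Finset.sum_add_distrib]
  rfl

lemma divergence_smul (r : ℝ) {q : Plane → Plane} (hq : q ∈ RT0) (x : Plane) :
    divergence (r • q) x = r * divergence q x := by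
  have h2 := (RT0.contDiff hq).differentiable (by norm_num) x
  simp only [divergence, fderiv_const_smul h2, Finset.mul_sum]
  rfl

lemma continuous_divergence {q : Plane → Plane} (hq : q ∈ RT0) : Continuous (divergence q) := by
  have h := (RT0.contDiff hq).continuous_fderiv (by norm_num)
  unfold divergence
  fun_prop

lemma Element.isCompact (K : T.Element) : IsCompact K.closedCell :=
  K.1.finite_toSet.isCompact_convexHull ℝ

lemma Element.integrableOn (K : T.Element) {g : Plane → ℝ} (hg : Continuous g) :
    IntegrableOn g K.cell :=
  (hg.continuousOn.integrableOn_compact (Element.isCompact K)).mono_set interior_subset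

lemma Edge.integrableOn (e : T.Edge) {g : Plane → ℝ} (hg : Continuous g) :
    IntegrableOn g e.closedCell (Measure.hausdorffMeasure 1 : Measure Plane) := by
  have hc : IsCompact e.closedCell := e.1.finite_toSet.isCompact_convexHull ℝ
  obtain ⟨C, hC⟩ := hc.exists_bound_of_continuousOn hg.continuousOn
  refine Measure.integrableOn_of_bounded (M := C) ?_ hg.aestronglyMeasurable
    ((ae_restrict_iff' hc.measurableSet).2 (Filter.Eventually.of_forall hC))
  obtain ⟨a, b, -, hab⟩ := Finset.card_eq_two.1 e.2.2
  have : e.closedCell = segment ℝ a b := by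
    simp [Edge.closedCell, hab, convexHull_pair]
  rw [this, hausdorffMeasure_segment]
  exact edist_ne_top _ _

lemma Element.cell_nonempty (K : T.Element) : K.cell.Nonempty := by
  have hi := T.complex.indep K.2.1
  have h := (hi.affineSpan_eq_top_iff_card_eq_finrank_add_one).2 (by simp [K.2.2])
  rw [Subtype.range_coe_subtype] at h
  exact interior_convexHull_nonempty_iff_affineSpan_eq_top.2 h

instance : FiniteDimensional ℝ RT0 := by
  let Φ : (Plane × ℝ) →ₗ[ℝ] (Plane → Plane) :=
    { toFun := fun w x => w.1 + w.2 • x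
      map_add' := fun v w => by funext x; simp [add_smul]; abel
      map_smul' := fun r w => by funext x; simp [smul_smul] }
  have h : RT0 ≤ LinearMap.range Φ := by
    rintro q ⟨a, c, h⟩
    exact ⟨(a, c), (funext h).symm⟩
  exact Submodule.finiteDimensional_of_le h

/-- The weak gradient is well defined. -/
theorem existsUnique_isWeakGradient (v : DiscreteFunction T) (K : T.Element) :
    ∃! p, IsWeakGradient v K p := by
  have hcont : ∀ q : RT0, Continuous q.1 := fun q => (RT0.contDiff q.2).continuous
  have hint : ∀ p q : RT0, IntegrableOn (fun x => inner ℝ (p.1 x) (q.1 x)) K.cell := fun p q =>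
    Element.integrableOn K ((hcont p).inner (hcont q))
  have hdiv : ∀ q : RT0, IntegrableOn (fun x => v.elem K * divergence q.1 x) K.cell := fun q =>
    Element.integrableOn K (continuous_const.mul (continuous_divergence q.2))
  have hedge : ∀ (q : RT0) (e : T.Edge),
      IntegrableOn (fun x => v.edge e * inner ℝ (q.1 x) (outwardNormal K e)) e.closedCell
        (Measure.hausdorffMeasure 1 : Measure Plane) := fun q e =>
    Edge.integrableOn e (continuous_const.mul ((hcont q).inner continuous_const))
  let B : RT0 →ₗ[ℝ] Module.Dual ℝ RT0 := LinearMap.mk₂ ℝ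
    (fun p q => ∫ x in K.cell, inner ℝ (p.1 x) (q.1 x))
    (fun p p' q => by
      simp only [Submodule.coe_add, Pi.add_apply, inner_add_left]
      exact integral_add (hint p q) (hint p' q))
    (fun r p q => by
      simp only [Submodule.coe_smul, Pi.smul_apply, real_inner_smul_left, smul_eq_mul]
      exact integral_const_mul _ _)
    (fun p q q' => by
      simp only [Submodule.coe_add, Pi.add_apply, inner_add_right]
      exact integral_add (hint p q) (hint p q'))
    (fun r p q => by
      simp only [Submodule.coe_smul, Pi.smul_apply, real_inner_smul_right, smul_eq_mul]
      exact integral_const_mul _ _)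
  let F : Module.Dual ℝ RT0 :=
    { toFun := fun q => -(∫ x in K.cell, v.elem K * divergence q.1 x) +
        ∑ e ∈ K.edges, ∫ x in e.closedCell,
          v.edge e * inner ℝ (q.1 x) (outwardNormal K e)
            ∂(Measure.hausdorffMeasure 1 : Measure Plane)
      map_add' := fun p q => by
        have h1 : ∫ x in K.cell, v.elem K * divergence (p + q : RT0).1 x =
            (∫ x in K.cell, v.elem K * divergence p.1 x) +
              ∫ x in K.cell, v.elem K * divergence q.1 x := by
          rw [← integral_add (hdiv p) (hdiv q)]
          congr 1; funext x
          rw [Submodule.coe_add, divergence_add p.2 q.2, mul_add]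
        have h2 : ∀ e : T.Edge, ∫ x in e.closedCell,
            v.edge e * inner ℝ ((p + q : RT0).1 x) (outwardNormal K e)
              ∂(Measure.hausdorffMeasure 1 : Measure Plane) =
            (∫ x in e.closedCell, v.edge e * inner ℝ (p.1 x) (outwardNormal K e)
              ∂(Measure.hausdorffMeasure 1 : Measure Plane)) +
            ∫ x in e.closedCell, v.edge e * inner ℝ (q.1 x) (outwardNormal K e)
              ∂(Measure.hausdorffMeasure 1 : Measure Plane) := fun e => by
          rw [← integral_add (hedge p e) (hedge q e)]
          congr 1; funext x
          rw [Submodule.coe_add, Pi.add_apply, inner_add_left, mul_add]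
        simp only [h1, h2, Finset.sum_add_distrib]
        ring
      map_smul' := fun r q => by
        have h1 : ∫ x in K.cell, v.elem K * divergence (r • q : RT0).1 x =
            r * ∫ x in K.cell, v.elem K * divergence q.1 x := by
          rw [← integral_const_mul]
          congr 1; funext x
          rw [Submodule.coe_smul, divergence_smul r q.2]; ring
        have h2 : ∀ e : T.Edge, ∫ x in e.closedCell,
            v.edge e * inner ℝ ((r • q : RT0).1 x) (outwardNormal K e)
              ∂(Measure.hausdorffMeasure 1 : Measure Plane) =
            r * ∫ x in e.closedCell, v.edge e * inner ℝ (q.1 x) (outwardNormal K e)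
              ∂(Measure.hausdorffMeasure 1 : Measure Plane) := fun e => by
          rw [← integral_const_mul]
          congr 1; funext x
          rw [Submodule.coe_smul, Pi.smul_apply, real_inner_smul_left]; ring
        simp only [h1, h2, ← Finset.mul_sum, RingHom.id_apply, smul_eq_mul]
        ring }
  have hinj : Function.Injective B := by
    rw [injective_iff_map_eq_zero]
    intro p hp
    have h0 : ∫ x in K.cell, inner ℝ (p.1 x) (p.1 x) = 0 := by
      exact LinearMap.congr_fun hp p
    have hz := (setIntegral_eq_zero_iff_of_nonneg_ae
      (Filter.Eventually.of_forall fun x => real_inner_self_nonneg) (hint p p)).1 h0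
    have hEq := Measure.eqOn_open_of_ae_eq hz isOpen_interior
      ((hcont p).inner (hcont p)).continuousOn continuousOn_const
    have hzero : ∀ x ∈ K.cell, p.1 x = 0 := fun x hx => inner_self_eq_zero.1 (hEq hx)
    obtain ⟨a, c, hac⟩ := p.2
    obtain ⟨x₀, hx₀⟩ := Element.cell_nonempty K
    have hc : c = 0 := by
      have h := isOpen_interior.mem_nhds hx₀
      have hlim : Filter.Tendsto (fun t : ℝ => x₀ + t • (EuclideanSpace.single 0 1 : Plane))
          (nhdsWithin 0 {0}ᶜ) (nhds x₀) := by
        have : Continuous (fun t : ℝ => x₀ + t • (EuclideanSpace.single 0 1 : Plane)) := by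
          fun_prop
        simpa using (this.tendsto 0).mono_left nhdsWithin_le_nhds
      obtain ⟨t, ht, ht0⟩ := ((hlim.eventually h).and self_mem_nhdsWithin).exists
      have e1 := hzero _ ht
      have e2 := hzero _ hx₀
      rw [hac] at e1 e2
      have e3 : (c * t) • (EuclideanSpace.single 0 1 : Plane) = 0 := by
        rw [mul_smul]
        have := congrArg₂ (· - ·) e1 e2
        simpa [smul_add] using this
      rcases smul_eq_zero.1 e3 with h | h
      · exact (mul_eq_zero.1 h).resolve_right ht0
      · exact absurd (congrArg (fun w : Plane => w 0) h) (by simp)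
    have ha : a = 0 := by
      have e2 := hzero _ hx₀
      rw [hac, hc] at e2
      simpa using e2
    ext1; funext x
    rw [hac, ha, hc]; simp
  have hsurj : Function.Surjective B :=
    (LinearMap.injective_iff_surjective_of_finrank_eq_finrank
      Subspace.dual_finrank_eq.symm).1 hinj
  obtain ⟨p, hp⟩ := hsurj F
  refine ⟨p.1, ⟨p.2, fun q hq => LinearMap.congr_fun hp ⟨q, hq⟩⟩, ?_⟩
  rintro p' ⟨hp', h⟩
  have : B ⟨p', hp'⟩ = B p := by
    rw [hp]
    exact LinearMap.ext fun q => h q.1 q.2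
  exact congrArg Subtype.val (hinj this)

end Existence

/-- The weak gradient of `v` on the element `K`. -/
def weakGradient {T : TriangularMesh Ω} (v : DiscreteFunction T) (K : T.Element) : Plane → Plane :=
  (existsUnique_isWeakGradient v K).exists.choose

/-- `u` is a weak Galerkin approximation with diffusion matrix `A`, right-hand side `f` and discrete
boundary data `g`: `u_b = g` on the boundary edges, and `(A ∇_w u, ∇_w v) = (f, v₀)` for every `v` in
`V_h` with `v_b = 0` on the boundary edges. -/
def IsWeakGalerkinSolution (T : TriangularMesh Ω) (A : Plane → Matrix (Fin 2) (Fin 2) ℝ)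
    (f : Plane → ℝ) (g : {e : T.Edge // e.IsBoundary} → ℝ) (u : DiscreteFunction T) : Prop :=
  (∀ e, u.edge e.1 = g e) ∧
    ∀ v : DiscreteFunction T, (∀ e : T.Edge, e.IsBoundary → v.edge e = 0) →
      ∑ K : T.Element,
          ∫ x in K.cell, matForm (A x) (weakGradient v K x) (weakGradient u K x) =
        ∑ K : T.Element, ∫ x in K.cell, f x * v.elem K

/-- The average `A_K` of `A` over the element `K`. -/
def average {T : TriangularMesh Ω} (A : Plane → Matrix (Fin 2) (Fin 2) ℝ) (K : T.Element) :
    Matrix (Fin 2) (Fin 2) ℝ :=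
  Matrix.of fun i j => ⨍ x in K.cell, A x i j

/-- `λ_{min,K}(A)`: the infimum over the interior of `K` of the minimal eigenvalue of `A x`. -/
def lambdaMin {T : TriangularMesh Ω} (A : Plane → Matrix (Fin 2) (Fin 2) ℝ) (K : T.Element) : ℝ :=
  ⨅ x : K.cell, sInf (spectrum ℝ (A x))

/-- The cosine of the angle at `p` between the segments from `p` to `q` and from `p` to `r`, measured
in the metric given by `G`. -/
def cosAngle (G : Matrix (Fin 2) (Fin 2) ℝ) (p q r : Plane) : ℝ :=
  matForm G (q - p) (r - p) /
    (Real.sqrt (matForm G (q - p) (q - p)) * Real.sqrt (matForm G (r - p) (r - p)))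

end WeakGalerkin

end

/-!
On a triangle with centroid `x_K`, an `RT₀` field is `a + s (x - x_K)`, and the weak gradient of
`v` has as its constant part `v.grad K` the gradient of the nonconforming affine interpolant of
the edge values, while its radial coefficient `s` depends on the element value. The element
values can hence be eliminated locally: each one is a weighted mean of the three edge values plus
a multiple of `∫ f`, and the edge values solve a discrete problem whose local energy is a Schur
complement `K.schur A`. Since `x - x_K` has mean zero, only the oscillation of `A` couples the
two parts. The angle condition absorbs this coupling and makes all products of different edge
normals nonpositive, and the shape condition makes the weights nonnegative.

Testing with the positive part `(u_b - M)⁺` of the excess over the maximum `M` of the boundary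
values then shows that this function has gradient zero, so that it is constant on the edges of
each element. Finally, the elements on whose edges such a function takes a given value have an
extreme vertex, and the clockwise-most edge there has all of them on one side. It must be a
boundary edge, because across an interior edge the value would propagate to the neighbouring
element.
-/

noncomputable section

namespace WeakGalerkin

section PlaneVectors

/-- The cross product of two vectors of the plane, that is, the determinant of the matrix with these
columns. It is positive when the second vector is counterclockwise of the first one. -/
def cross (u v : Plane) : ℝ := u 0 * v 1 - u 1 * v 0

/-- The clockwise rotation by a right angle, which takes the tangents of a triangle with
counterclockwise boundary to its outward normals. -/
def rot (u : Plane) : Plane := !₂[u 1, -u 0]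

lemma inner_eq_add (u v : Plane) : inner ℝ u v = u 0 * v 0 + u 1 * v 1 := by
  simp [PiLp.inner_apply, Fin.sum_univ_two, mul_comm]

lemma norm_sq_eq_add (u : Plane) : ‖u‖ ^ 2 = u 0 ^ 2 + u 1 ^ 2 := by
  rw [EuclideanSpace.real_norm_sq_eq, Fin.sum_univ_two]

@[simp] lemma cross_zero_right (u : Plane) : cross u 0 = 0 := by simp [cross]

@[simp] lemma cross_self (u : Plane) : cross u u = 0 := by simp [cross, mul_comm]

lemma cross_anticomm (u v : Plane) : cross u v = -cross v u := by simp only [cross]; ring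

lemma cross_add_right (u v w : Plane) : cross u (v + w) = cross u v + cross u w := by
  simp only [cross, PiLp.add_apply]; ring

lemma cross_sub_right (u v w : Plane) : cross u (v - w) = cross u v - cross u w := by
  simp only [cross, PiLp.sub_apply]; ring

lemma cross_smul_right (r : ℝ) (u v : Plane) : cross u (r • v) = r * cross u v := by
  simp only [cross, PiLp.smul_apply, smul_eq_mul]; ring

lemma inner_rot_right (u v : Plane) : inner ℝ u (rot v) = cross u v := by
  simp only [inner_eq_add, cross, rot, Matrix.cons_val_zero, Matrix.cons_val_one]
  ring

lemma norm_rot (u : Plane) : ‖rot u‖ = ‖u‖ := by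
  rw [← sq_eq_sq₀ (norm_nonneg _) (norm_nonneg _), norm_sq_eq_add, norm_sq_eq_add]
  simp only [rot, PiLp.toLp_apply, Matrix.cons_val_zero, Matrix.cons_val_one]
  ring

lemma cross_rot_self (u : Plane) : cross u (rot u) = -‖u‖ ^ 2 := by
  rw [norm_sq_eq_add]
  simp only [cross, rot, PiLp.toLp_apply, Matrix.cons_val_zero, Matrix.cons_val_one]
  ring

lemma starProjection_orthogonal_span_singleton {t : Plane} (ht : t ≠ 0) (x : Plane) :
    (Submodule.span ℝ {t})ᗮ.starProjection x = (cross x t / ‖t‖ ^ 2) • rot t := by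
  have ht' : t 0 ^ 2 + t 1 ^ 2 ≠ 0 := by
    rw [← norm_sq_eq_add]
    exact pow_ne_zero 2 (norm_ne_zero_iff.2 ht)
  rw [Submodule.starProjection_orthogonal_val, Submodule.starProjection_singleton,
    inner_eq_add, RCLike.ofReal_real_eq_id, id, norm_sq_eq_add]
  ext i
  fin_cases i <;> simp [cross, rot] <;> field_simp <;> ring

/-- Take the point farthest from the origin, with the inner normal of the sphere there. -/
lemma exists_forall_inner_sub_pos {E : Type*} [NormedAddCommGroup E] [InnerProductSpace ℝ E]
    {s : Set E} (hfin : s.Finite) (hs : s.Nonempty) :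
    ∃ p ∈ s, ∃ n : E, ∀ x ∈ s, x ≠ p → 0 < inner ℝ n (x - p) := by
  obtain ⟨p, hp, hmax⟩ := exists_max_image s norm hfin hs
  refine ⟨p, hp, -p, fun x hx hne => ?_⟩
  have hle : ‖p + (x - p)‖ ^ 2 ≤ ‖p‖ ^ 2 := by
    rw [add_sub_cancel]
    exact pow_le_pow_left₀ (norm_nonneg x) (hmax x hx) 2
  rw [norm_add_sq_real] at hle
  rw [inner_neg_left]
  linarith [pow_pos (norm_pos_iff.2 (sub_ne_zero.2 hne)) 2]

lemma exists_forall_cross_nonneg {ι : Type*} {s : Set ι} (hfin : s.Finite) (hs : s.Nonempty)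
    {v : ι → Plane} {n : Plane} (hn : ∀ i ∈ s, 0 < inner ℝ n (v i)) :
    ∃ j ∈ s, ∀ i ∈ s, 0 ≤ cross (v j) (v i) := by
  -- the clockwise-most vector minimizes the tangent of its angle with `n`
  obtain ⟨j, hj, hmin⟩ := exists_min_image s (fun i => cross n (v i) / inner ℝ n (v i)) hfin hs
  refine ⟨j, hj, fun i hi => ?_⟩
  have htan : cross n (v j) * inner ℝ n (v i) ≤ cross n (v i) * inner ℝ n (v j) :=
    (div_le_div_iff₀ (hn j hj) (hn i hi)).1 (hmin i hi)
  have hid : ‖n‖ ^ 2 * cross (v j) (v i) =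
      cross n (v i) * inner ℝ n (v j) - cross n (v j) * inner ℝ n (v i) := by
    simp only [norm_sq_eq_add, inner_eq_add, cross]
    ring
  have hn0 : n ≠ 0 := by
    rintro rfl
    simpa using hn j hj
  exact nonneg_of_mul_nonneg_right (hid ▸ sub_nonneg.2 htan)
    (pow_pos (norm_pos_iff.2 hn0) 2)

end PlaneVectors

section Matrices

lemma forall_mul_dotProduct_le_iff_le_sInf_spectrum {n : Type*} [Fintype n] [DecidableEq n]
    [Nonempty n] {B : Matrix n n ℝ} (hB : B.IsSymm) {c : ℝ} :
    (∀ x : n → ℝ, c * (x ⬝ᵥ x) ≤ x ⬝ᵥ B.mulVec x) ↔ c ≤ sInf (spectrum ℝ B) := by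
  have hB' : B.IsHermitian := Matrix.isHermitian_iff_isSymm.2 hB
  have hne : (spectrum ℝ B).Nonempty := by
    rw [hB'.spectrum_real_eq_range_eigenvalues]
    exact range_nonempty _
  have hC : (B - c • 1).IsHermitian := hB'.sub (Matrix.isHermitian_one.smul (IsSelfAdjoint.all c))
  calc (∀ x : n → ℝ, c * (x ⬝ᵥ x) ≤ x ⬝ᵥ B.mulVec x) ↔ (B - c • 1).PosSemidef := by
        simp [Matrix.posSemidef_iff_dotProduct_mulVec, -Matrix.isHermitian_iff_isSymm, hC,
          Matrix.sub_mulVec, Matrix.smul_mulVec, dotProduct_sub]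
    _ ↔ ∀ t ∈ spectrum ℝ B, c ≤ t := by
        rw [Matrix.posSemidef_iff_isHermitian_and_spectrum_nonneg, and_iff_right hC,
          ← Algebra.algebraMap_eq_smul_one, ← spectrum.sub_singleton_eq]
        simp [Set.subset_def]
    _ ↔ c ≤ sInf (spectrum ℝ B) :=
        (le_csInf_iff (Matrix.finite_real_spectrum (A := B)).bddBelow hne).symm

/-- The discrete counterpart of `∫ ∇u⁺ ⬝ ∇u⁻ ≤ 0`, the M-matrix property behind the maximum
principle. -/
lemma apply_sum_posPart_sum_negPart_nonpos {ι E : Type*} [Fintype ι] [AddCommGroup E] [Module ℝ E]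
    (B : LinearMap.BilinForm ℝ E) {n : ι → E} (h : ∀ i j, i ≠ j → B (n i) (n j) ≤ 0)
    (t : ι → ℝ) : B (∑ i, (t i)⁺ • n i) (∑ i, (t i)⁻ • n i) ≤ 0 := by
  simp only [LinearMap.BilinForm.sum_left, LinearMap.BilinForm.sum_right,
    LinearMap.BilinForm.smul_left, LinearMap.BilinForm.smul_right]
  refine Finset.sum_nonpos fun j _ => ?_
  rw [Finset.mul_sum]
  refine Finset.sum_nonpos fun i _ => ?_
  obtain rfl | hij := eq_or_ne i j
  · obtain h0 | h0 := le_total 0 (t i)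
    · simp [negPart_eq_zero.2 h0]
    · simp [posPart_eq_zero.2 h0]
  · exact mul_nonpos_of_nonneg_of_nonpos (negPart_nonneg _)
      (mul_nonpos_of_nonneg_of_nonpos (posPart_nonneg _) (h i j hij))

lemma apply_sum_posPart_self_le {ι E : Type*} [Fintype ι] [AddCommGroup E] [Module ℝ E]
    (B : LinearMap.BilinForm ℝ E) {n : ι → E} (h : ∀ i j, i ≠ j → B (n i) (n j) ≤ 0)
    (t : ι → ℝ) :
    B (∑ i, (t i)⁺ • n i) (∑ i, (t i)⁺ • n i) ≤ B (∑ i, (t i)⁺ • n i) (∑ i, t i • n i) := by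
  have hsplit : ∑ i, t i • n i = ∑ i, (t i)⁺ • n i - ∑ i, (t i)⁻ • n i := by
    simp only [← Finset.sum_sub_distrib, ← sub_smul, posPart_sub_negPart]
  rw [hsplit, map_sub, le_sub_self_iff]
  exact apply_sum_posPart_sum_negPart_nonpos B h t

lemma matForm_eq_inner (B : Matrix (Fin 2) (Fin 2) ℝ) (u v : Plane) :
    matForm B u v = inner ℝ u (Matrix.toEuclideanCLM (𝕜 := ℝ) B v) :=
  (Matrix.inner_toEuclideanCLM B u v).symm

/-- The form `matForm B` as a bilinear form. -/
def matBilin (B : Matrix (Fin 2) (Fin 2) ℝ) : LinearMap.BilinForm ℝ Plane :=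
  LinearMap.mk₂ ℝ (matForm B)
    (fun _ _ _ => by simp only [matForm_eq_inner, inner_add_left])
    (fun _ _ _ => by simp only [matForm_eq_inner, real_inner_smul_left, smul_eq_mul])
    (fun _ _ _ => by simp only [matForm_eq_inner, map_add, inner_add_right])
    (fun _ _ _ => by simp only [matForm_eq_inner, map_smul, real_inner_smul_right, smul_eq_mul])

lemma matBilin_apply (B : Matrix (Fin 2) (Fin 2) ℝ) (u v : Plane) :
    matBilin B u v = matForm B u v := rfl

lemma matForm_comm {B : Matrix (Fin 2) (Fin 2) ℝ} (hB : B.IsSymm) (u v : Plane) :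
    matForm B u v = matForm B v u := by
  rw [matForm, matForm, Matrix.dotProduct_mulVec, ← Matrix.mulVec_transpose, hB.eq, dotProduct_comm]

lemma abs_matForm_le (B : Matrix (Fin 2) (Fin 2) ℝ) (u v : Plane) :
    |matForm B u v| ≤ ‖B‖ * ‖u‖ * ‖v‖ := by
  rw [matForm_eq_inner]
  calc |inner ℝ u (Matrix.toEuclideanCLM (𝕜 := ℝ) B v)|
      ≤ ‖u‖ * ‖Matrix.toEuclideanCLM (𝕜 := ℝ) B v‖ := abs_real_inner_le_norm _ _
    _ ≤ ‖u‖ * (‖B‖ * ‖v‖) := by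
        gcongr
        exact (Matrix.toEuclideanCLM (𝕜 := ℝ) B).le_opNorm v
    _ = ‖B‖ * ‖u‖ * ‖v‖ := by ring

/-- The matrix `B` is elliptic with constant `c`. -/
def IsElliptic (c : ℝ) (B : Matrix (Fin 2) (Fin 2) ℝ) : Prop :=
  ∀ ξ : Plane, c * ‖ξ‖ ^ 2 ≤ matForm B ξ ξ

lemma isElliptic_iff_le_sInf_spectrum {B : Matrix (Fin 2) (Fin 2) ℝ} (hB : B.IsSymm) {c : ℝ} :
    IsElliptic c B ↔ c ≤ sInf (spectrum ℝ B) := by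
  rw [← forall_mul_dotProduct_le_iff_le_sInf_spectrum hB]
  refine ((EuclideanSpace.equiv (Fin 2) ℝ).forall_congr fun ξ => ?_)
  rw [EuclideanSpace.real_norm_sq_eq]
  simp [matForm, dotProduct, pow_two]

lemma IsElliptic.det_pos {B : Matrix (Fin 2) (Fin 2) ℝ} {c : ℝ} (h : IsElliptic c B) (hc : 0 < c)
    (hB : B.IsSymm) : 0 < B.det := by
  refine (Matrix.PosDef.of_dotProduct_mulVec_pos (Matrix.isHermitian_iff_isSymm.2 hB)
    fun x hx => ?_).det_pos
  have hx' : (WithLp.toLp 2 x : Plane) ≠ 0 := fun h0 => hx (congrArg WithLp.ofLp h0)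
  exact (mul_pos hc (pow_pos (norm_pos_iff.2 hx') 2)).trans_le (h (WithLp.toLp 2 x))

lemma matForm_rot {B : Matrix (Fin 2) (Fin 2) ℝ} (hB : B.IsSymm) (hdet : B.det ≠ 0)
    (u v : Plane) : matForm B (rot u) (rot v) = B.det * matForm B⁻¹ u v := by
  have hsymm : B 1 0 = B 0 1 := hB.apply 0 1
  have hinv : B⁻¹ = B.det⁻¹ • B.adjugate := by rw [Matrix.inv_def, Ring.inverse_eq_inv']
  simp only [hinv, Matrix.adjugate_fin_two, matForm, rot, dotProduct, Matrix.mulVec,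
    Fin.sum_univ_two, Matrix.smul_apply, Matrix.of_apply, Matrix.cons_val', Matrix.cons_val_zero,
    Matrix.cons_val_one, Matrix.cons_val_fin_one, smul_eq_mul, hsymm]
  field_simp
  ring

lemma cosAngle_inv {B : Matrix (Fin 2) (Fin 2) ℝ} (hB : B.IsSymm) (hdet : 0 < B.det)
    (p q r : Plane) : cosAngle B⁻¹ p q r = matForm B (rot (q - p)) (rot (r - p)) /
      (√(matForm B (rot (q - p)) (rot (q - p))) * √(matForm B (rot (r - p)) (rot (r - p)))) := by
  simp only [cosAngle, matForm_rot hB hdet.ne', Real.sqrt_mul hdet.le]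
  rw [mul_mul_mul_comm, Real.mul_self_sqrt hdet.le, mul_div_mul_left _ _ hdet.ne']

lemma IsElliptic.le_matForm_rot {B : Matrix (Fin 2) (Fin 2) ℝ} {c : ℝ} (h : IsElliptic c B)
    (hc : 0 < c) (hB : B.IsSymm) {κ : ℝ} (hκ : 0 ≤ κ) {p q r : Plane} (hqp : q ≠ p) (hrp : r ≠ p)
    (hcos : κ ≤ cosAngle B⁻¹ p q r) :
    κ * c * (‖q - p‖ * ‖r - p‖) ≤ matForm B (rot (q - p)) (rot (r - p)) := by
  have hsqrt (w : Plane) : √c * ‖w‖ ≤ √(matForm B (rot w) (rot w)) := by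
    rw [← Real.sqrt_sq (norm_nonneg w), ← Real.sqrt_mul hc.le, ← norm_rot]
    exact Real.sqrt_le_sqrt (h (rot w))
  have hpos {w : Plane} (hw : w ≠ 0) : 0 < √(matForm B (rot w) (rot w)) :=
    (mul_pos (Real.sqrt_pos.2 hc) (norm_pos_iff.2 hw)).trans_le (hsqrt w)
  rw [cosAngle_inv hB (h.det_pos hc hB),
    le_div_iff₀ (mul_pos (hpos (sub_ne_zero.2 hqp)) (hpos (sub_ne_zero.2 hrp)))] at hcos
  calc κ * c * (‖q - p‖ * ‖r - p‖) = κ * ((√c * ‖q - p‖) * (√c * ‖r - p‖)) := by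
        rw [mul_mul_mul_comm (√c), Real.mul_self_sqrt hc.le, mul_assoc]
    _ ≤ κ * (√(matForm B (rot (q - p)) (rot (q - p))) *
          √(matForm B (rot (r - p)) (rot (r - p)))) := by
        gcongr
        · exact hsqrt _
        · exact hsqrt _
    _ ≤ matForm B (rot (q - p)) (rot (r - p)) := hcos

end Matrices

section OpenSimplices

variable {𝕜 E : Type*} [Ring 𝕜] [PartialOrder 𝕜] [AddCommGroup E] [Module 𝕜 E] {s t : Finset E}
  {x : E}

variable (𝕜) in
/-- The relative interior of the simplex with vertex set `s`, described without a topology as the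
set of the points of the simplex that lie in no proper face. -/
def openSimplex (s : Finset E) : Set E :=
  {x ∈ convexHull 𝕜 (s : Set E) | ∀ t ⊂ s, x ∉ convexHull 𝕜 (t : Set E)}

lemma exists_subset_mem_openSimplex (hx : x ∈ convexHull 𝕜 (s : Set E)) :
    ∃ t ⊆ s, x ∈ openSimplex 𝕜 t := by
  induction s using Finset.strongInduction with
  | H s ih =>
    by_cases hmem : ∃ t ⊂ s, x ∈ convexHull 𝕜 (t : Set E)
    · obtain ⟨t, hts, hxt⟩ := hmem
      obtain ⟨r, hrt, hxr⟩ := ih t hts hxt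
      exact ⟨r, hrt.trans hts.subset, hxr⟩
    · push Not at hmem
      exact ⟨s, subset_rfl, hx, hmem⟩

lemma openSimplex_eq_diff_of_card_eq_two [IsOrderedRing 𝕜] (hs : s.card = 2) :
    openSimplex 𝕜 s = convexHull 𝕜 (s : Set E) \ s := by
  refine Subset.antisymm (fun x hx => ⟨hx.1, fun hxs => hx.2 {x} ?_ (by simp)⟩)
    fun x hx => ⟨hx.1, fun t hts hxt => hx.2 ?_⟩
  · refine (Finset.singleton_subset_iff.2 hxs).ssubset_of_ne fun h => ?_
    simp [← h] at hs
  · have hcard : t.card ≤ 1 := by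
      have := Finset.card_lt_card hts
      lia
    have hsub : (t : Set E).Subsingleton :=
      fun _ ha _ hb => Finset.card_le_one.1 hcard _ ha _ hb
    rw [hsub.convex.convexHull_eq] at hxt
    exact hts.subset hxt

variable {C : Geometry.SimplicialComplex 𝕜 E}

lemma subset_of_mem_openSimplex (hs : s ∈ C.faces) (ht : t ∈ C.faces) (hxs : x ∈ openSimplex 𝕜 s)
    (hxt : x ∈ convexHull 𝕜 (t : Set E)) : s ⊆ t := by
  classical
  by_contra hst
  refine hxs.2 (s ∩ t) (Finset.inter_subset_left.ssubset_of_ne fun h => hst ?_) ?_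
  · exact Finset.inter_eq_left.1 h
  · rw [Finset.coe_inter]
    exact C.inter_subset_convexHull hs ht ⟨hxs.1, hxt⟩

lemma eq_of_mem_openSimplex (hs : s ∈ C.faces) (ht : t ∈ C.faces) (hxs : x ∈ openSimplex 𝕜 s)
    (hxt : x ∈ openSimplex 𝕜 t) : s = t :=
  (subset_of_mem_openSimplex hs ht hxs hxt.1).antisymm (subset_of_mem_openSimplex ht hs hxt hxs.1)

lemma exists_face_mem_openSimplex (hx : x ∈ C.space) : ∃ s ∈ C.faces, x ∈ openSimplex 𝕜 s := by
  obtain ⟨s, hs, hxs⟩ := Geometry.SimplicialComplex.mem_space_iff.1 hx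
  obtain ⟨t, hts, hxt⟩ := exists_subset_mem_openSimplex hxs
  have hne : t.Nonempty := Finset.coe_nonempty.1 (convexHull_nonempty_iff.1 ⟨x, hxt.1⟩)
  exact ⟨t, C.down_closed hs hts hne, hxt⟩

/-- A barycentric coordinate vanishes exactly on the hyperplane spanned by a facet. -/
lemma interior_convexHull_eq_openSimplex {E : Type*} [NormedAddCommGroup E] [NormedSpace ℝ E]
    {s : Finset E} (hind : AffineIndependent ℝ ((↑) : s → E))
    (hspan : affineSpan ℝ (s : Set E) = ⊤) :
    interior (convexHull ℝ (s : Set E)) = openSimplex ℝ s := by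
  classical
  let b : AffineBasis s ℝ E := ⟨(↑), hind, by simpa using hspan⟩
  have hb : range b = s := Subtype.range_coe
  rw [← hb, b.interior_convexHull]
  refine Subset.antisymm (fun x hx => ⟨?_, fun t hts hxt => ?_⟩) fun x hx i => ?_
  · rw [← hb, b.convexHull_eq_nonneg_coord]
    exact fun i => (hx i).le
  · obtain ⟨y, hys, hyt⟩ := Finset.exists_of_ssubset hts
    have hface : (t : Set E) ⊆ {z | b.coord ⟨y, hys⟩ z = 0} := fun z hz =>
      b.coord_apply_ne (j := ⟨z, hts.subset hz⟩) fun h =>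
        hyt ((Subtype.mk.inj h : y = z) ▸ hz)
    have hconv : Convex ℝ {z | b.coord ⟨y, hys⟩ z = 0} :=
      (convex_singleton 0).affine_preimage (b.coord ⟨y, hys⟩)
    exact (hx ⟨y, hys⟩).ne' (convexHull_min hface hconv hxt)
  · have hnonneg : ∀ j, 0 ≤ b.coord j x := by
      have := hx.1
      rwa [← hb, b.convexHull_eq_nonneg_coord] at this
    refine (hnonneg i).lt_of_ne fun h0 => hx.2 (s.erase i) (Finset.erase_ssubset i.2) ?_
    have hi : b.coord i x • b i = 0 := by rw [← h0, zero_smul]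
    rw [← b.linear_combination_coord_eq_self x,
      ← Finset.sum_erase (f := fun j => b.coord j x • b j) Finset.univ hi]
    refine (convex_convexHull ℝ _).sum_mem (fun j _ => hnonneg j) ?_ fun j hj => ?_
    · rw [Finset.sum_erase (f := fun j => b.coord j x) _ h0.symm, b.sum_coord_apply_eq_one]
    · refine subset_convexHull ℝ _ (Finset.mem_erase.2 ⟨fun h => ?_, j.2⟩)
      exact (Finset.mem_erase.1 hj).1 (Subtype.ext h)

end OpenSimplices

section VertexSwaps

variable {ι k V : Type*} [Ring k] [AddCommGroup V] [Module k V] (b : AffineBasis ι k V)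

/-- The affine map that exchanges the vertices `b i` and `b j` and fixes the other ones. -/
def swapVertices (i j : ι) (x : V) : V := x + (b.coord j x - b.coord i x) • (b i - b j)

lemma coord_swapVertices [DecidableEq ι] (i j l : ι) (x : V) :
    b.coord l (swapVertices b i j x) = b.coord (Equiv.swap i j l) x := by
  have hx : swapVertices b i j x = (b.coord j x - b.coord i x) • (b i -ᵥ b j) +ᵥ x :=
    add_comm _ _
  rw [hx, AffineMap.map_vadd, map_smul, AffineMap.linearMap_vsub]
  obtain rfl | hij := eq_or_ne i j
  · simp
  obtain rfl | hli := eq_or_ne l i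
  · simp [hij]
  obtain rfl | hlj := eq_or_ne l j
  · simp [hli]
  · simp [hli, hlj, Equiv.swap_apply_of_ne_of_ne]

lemma swapVertices_involutive (i j : ι) : Function.Involutive (swapVertices b i j) := by
  classical
  intro x
  rw [swapVertices, coord_swapVertices, coord_swapVertices, Equiv.swap_apply_left,
    Equiv.swap_apply_right, swapVertices, add_assoc, ← add_smul]
  simp

end VertexSwaps

section VertexSwaps

variable {ι E : Type*} [NormedAddCommGroup E] [NormedSpace ℝ E] (b : AffineBasis ι ℝ E)

lemma image_swapVertices_interior_convexHull [Finite ι] (i j : ι) :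
    swapVertices b i j '' interior (convexHull ℝ (range b)) =
      interior (convexHull ℝ (range b)) := by
  classical
  rw [(swapVertices_involutive b i j).image_eq_preimage_symm, b.interior_convexHull]
  ext x
  simp only [mem_preimage, mem_ofPred_eq, coord_swapVertices]
  exact (Equiv.swap i j).forall_congr fun k => Iff.rfl

lemma exists_hasFDerivAt_swapVertices [FiniteDimensional ℝ E] {i j : ι} (hij : i ≠ j) :
    ∃ f : E →L[ℝ] E, f.det = -1 ∧ ∀ x, HasFDerivAt (swapVertices b i j) f x := by
  let ℓ : Module.Dual ℝ E := (b.coord j).linear - (b.coord i).linear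
  have hlinear (k : ι) (x y : E) : (b.coord k).linear (x - y) = b.coord k x - b.coord k y :=
    (b.coord k).linearMap_vsub x y
  refine ⟨(LinearMap.transvection ℓ (b i - b j)).toContinuousLinearMap, ?_, fun x => ?_⟩
  · rw [ContinuousLinearMap.det, LinearMap.coe_toContinuousLinearMap, LinearMap.transvection.det]
    simp only [ℓ, LinearMap.sub_apply, hlinear, b.coord_apply_eq, b.coord_apply_ne hij,
      b.coord_apply_ne hij.symm]
    norm_num
  · convert (LinearMap.transvection ℓ (b i - b j)).toContinuousLinearMap.hasFDerivAt.add_const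
      (swapVertices b i j 0) using 1
    ext y
    have hy (k : ι) : (b.coord k).linear y = b.coord k y - b.coord k 0 := by
      rw [← hlinear, sub_zero]
    simp only [swapVertices, ℓ, LinearMap.coe_toContinuousLinearMap',
      LinearMap.transvection.apply, LinearMap.sub_apply, hy]
    module

end VertexSwaps

section SimplexIntegrals

variable {ι E : Type*} [NormedAddCommGroup E] [NormedSpace ℝ E] [MeasurableSpace E]
  [BorelSpace E] (μ : Measure E) [μ.IsAddHaarMeasure] (b : AffineBasis ι ℝ E)

lemma setIntegral_coord_eq [Finite ι] (i j : ι) :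
    ∫ x in interior (convexHull ℝ (range b)), b.coord i x ∂μ =
      ∫ x in interior (convexHull ℝ (range b)), b.coord j x ∂μ := by
  classical
  have : FiniteDimensional ℝ E := b.finiteDimensional
  obtain rfl | hij := eq_or_ne i j
  · rfl
  obtain ⟨f, hdet, hderiv⟩ := exists_hasFDerivAt_swapVertices b hij
  rw [← image_swapVertices_interior_convexHull b i j,
    integral_image_eq_integral_abs_det_fderiv_smul μ isOpen_interior.measurableSet
      (fun x _ => (hderiv x).hasFDerivWithinAt) (swapVertices_involutive b i j).injective.injOn,
    image_swapVertices_interior_convexHull]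
  simp [coord_swapVertices, hdet]

lemma setIntegral_coord [Fintype ι] (i : ι) :
    ∫ x in interior (convexHull ℝ (range b)), b.coord i x ∂μ =
      μ.real (interior (convexHull ℝ (range b))) / Fintype.card ι := by
  have : FiniteDimensional ℝ E := b.finiteDimensional
  have hint (j : ι) :
      Integrable (fun x => b.coord j x) (μ.restrict (interior (convexHull ℝ (range b)))) :=
    ((b.coord j).continuous_of_finiteDimensional.continuousOn.integrableOn_compact
      ((finite_range b).isCompact_convexHull ℝ)).mono_set interior_subset
  have hsum : ∑ j, ∫ x in interior (convexHull ℝ (range b)), b.coord j x ∂μ =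
      μ.real (interior (convexHull ℝ (range b))) := by
    rw [← integral_finsetSum _ fun j _ => hint j]
    simp [b.sum_coord_apply_eq_one]
  have : Nonempty ι := ⟨i⟩
  rw [eq_div_iff (by simp), ← hsum, Finset.sum_congr rfl fun j _ => setIntegral_coord_eq μ b j i]
  simp [mul_comm]

lemma volume_real_stdTriangle :
    volume.real {z : Plane | 0 < z 0 ∧ 0 < z 1 ∧ z 0 + z 1 < 1} = 1 / 2 := by
  have hregion : {z : Plane | 0 < z 0 ∧ 0 < z 1 ∧ z 0 + z 1 < 1} =
      (fun z : Plane => (z 0, z 1)) ⁻¹'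
        regionBetween (fun _ => 0) (fun s : ℝ => 1 - s) (Ioo 0 1) := by
    ext z
    simp only [regionBetween, mem_preimage, mem_ofPred_eq, mem_Ioo, lt_sub_iff_add_lt']
    exact ⟨fun ⟨h0, h1, h2⟩ => ⟨⟨h0, by linarith⟩, h1, h2⟩, fun ⟨h0, h1, h2⟩ => ⟨h0.1, h1, h2⟩⟩
  have hmp : MeasurePreserving (fun z : Plane => (z 0, z 1)) :=
    (volume_preserving_finTwoArrow ℝ).comp (PiLp.volume_preserving_ofLp (Fin 2))
  have hint (g : ℝ → ℝ) (hg : Continuous g) : IntegrableOn g (Ioo 0 1) :=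
    (hg.continuousOn.integrableOn_compact isCompact_Icc).mono_set Ioo_subset_Icc_self
  rw [hregion, measureReal_def, hmp.measure_preimage
    (measurableSet_regionBetween (by fun_prop) (by fun_prop) measurableSet_Ioo).nullMeasurableSet,
    Measure.volume_eq_prod, volume_regionBetween_eq_integral (hint _ (by fun_prop))
      (hint _ (by fun_prop)) measurableSet_Ioo fun s hs => by linarith [hs.2]]
  simp only [Pi.sub_apply, sub_zero]
  rw [← integral_Ioc_eq_integral_Ioo, ← intervalIntegral.integral_of_le zero_le_one]
  have hval : ∫ s in (0 : ℝ)..1, (1 - s) = 1 / 2 := by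
    simp [intervalIntegral.integral_comp_sub_left fun s : ℝ => s]
  rw [hval, ENNReal.toReal_ofReal (by norm_num)]

/-- The linear map that sends the unit vectors of the plane to `u` and `v`. -/
def linearMapOfImages (u v : Plane) : Plane →L[ℝ] Plane :=
  (EuclideanSpace.proj (0 : Fin 2)).smulRight u + (EuclideanSpace.proj (1 : Fin 2)).smulRight v

lemma linearMapOfImages_apply (u v z : Plane) : linearMapOfImages u v z = z 0 • u + z 1 • v := rfl

lemma det_linearMapOfImages (u v : Plane) : (linearMapOfImages u v).det = cross u v := by
  rw [ContinuousLinearMap.det,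
    ← LinearMap.det_toMatrix (EuclideanSpace.basisFun (Fin 2) ℝ).toBasis, Matrix.det_fin_two]
  simp only [LinearMap.toMatrix_apply, OrthonormalBasis.coe_toBasis, EuclideanSpace.basisFun_apply,
    ContinuousLinearMap.coe_coe, linearMapOfImages_apply,
    OrthonormalBasis.coe_toBasis_repr_apply, EuclideanSpace.basisFun_repr]
  simp [cross, mul_comm]

lemma interior_convexHull_eq_image_stdTriangle (b : AffineBasis (Fin 3) ℝ Plane) :
    interior (convexHull ℝ (range b)) = (fun z => b 0 + z) ''
      (linearMapOfImages (b 1 - b 0) (b 2 - b 0) '' {z | 0 < z 0 ∧ 0 < z 1 ∧ z 0 + z 1 < 1}) := by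
  have hcoord (i : Fin 3) (z : Plane) :
      b.coord i (b 0 + linearMapOfImages (b 1 - b 0) (b 2 - b 0) z) =
        b.coord i (b 0) + (z 0 * (b.coord i (b 1) - b.coord i (b 0)) +
          z 1 * (b.coord i (b 2) - b.coord i (b 0))) := by
    rw [add_comm, ← vadd_eq_add, AffineMap.map_vadd, linearMapOfImages_apply, map_add, map_smul,
      map_smul, ← vsub_eq_sub, ← vsub_eq_sub, AffineMap.linearMap_vsub, AffineMap.linearMap_vsub]
    simp [add_comm]
  rw [b.interior_convexHull, image_image]
  refine Subset.antisymm (fun x hx => ?_) ?_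
  · have hsum := b.sum_coord_apply_eq_one x
    have hx' := b.linear_combination_coord_eq_self x
    rw [Fin.sum_univ_three] at hsum hx'
    refine ⟨!₂[b.coord 1 x, b.coord 2 x], ⟨hx 1, hx 2, ?_⟩, ?_⟩
    · have := hx 0
      simp only [Matrix.cons_val_zero, Matrix.cons_val_one]
      linarith
    · have h0 : b.coord 0 x = 1 - b.coord 1 x - b.coord 2 x := by linarith
      rw [h0] at hx'
      convert hx' using 1
      simp only [linearMapOfImages_apply, Matrix.cons_val_zero, Matrix.cons_val_one]
      module
  · rintro _ ⟨z, ⟨h0, h1, h2⟩, rfl⟩ i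
    rw [hcoord]
    fin_cases i <;> simp [b.coord_apply] <;> linarith

lemma volume_real_interior_convexHull (b : AffineBasis (Fin 3) ℝ Plane) :
    volume.real (interior (convexHull ℝ (range b))) = |cross (b 1 - b 0) (b 2 - b 0)| / 2 := by
  rw [interior_convexHull_eq_image_stdTriangle, image_add_left, measureReal_def,
    measure_preimage_add, Measure.addHaar_image_continuousLinearMap, ENNReal.toReal_mul,
    ← measureReal_def, volume_real_stdTriangle, ← ContinuousLinearMap.det,
    det_linearMapOfImages, ENNReal.toReal_ofReal (abs_nonneg _)]
  ring

end SimplexIntegrals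

section Elements

variable {Ω : Set Plane} {T : TriangularMesh Ω}

namespace TriangularMesh.Element

variable (K : T.Element)

lemma affineIndependent : AffineIndependent ℝ ((↑) : K.1 → Plane) := T.complex.indep K.2.1

lemma affineSpan_eq_top : affineSpan ℝ (K.1 : Set Plane) = ⊤ := by
  have h := K.affineIndependent.affineSpan_eq_top_iff_card_eq_finrank_add_one.2 (by simp [K.2.2])
  rwa [Subtype.range_coe_subtype] at h

lemma area_pos : 0 < K.area :=
  ENNReal.toReal_pos (isOpen_interior.measure_pos volume (Element.cell_nonempty K)).ne'
    ((measure_mono interior_subset).trans_lt (Element.isCompact K).measure_lt_top).ne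

lemma exists_affineBasis : ∃ b : AffineBasis (Fin 3) ℝ Plane, range b = K.1 := by
  let b : AffineBasis K.1 ℝ Plane :=
    ⟨(↑), K.affineIndependent, by simpa using K.affineSpan_eq_top⟩
  refine ⟨b.reindex (Fintype.equivFinOfCardEq (by simp [K.2.2])), ?_⟩
  rw [AffineBasis.coe_reindex, EquivLike.range_comp]
  exact Subtype.range_coe

lemma exists_affineBasis_cross_pos :
    ∃ b : AffineBasis (Fin 3) ℝ Plane, range b = K.1 ∧ 0 < cross (b 1 - b 0) (b 2 - b 0) := by
  obtain ⟨b, hb⟩ := K.exists_affineBasis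
  have hne : cross (b 1 - b 0) (b 2 - b 0) ≠ 0 := fun h => by
    have harea := K.area_pos
    rw [area, cell, closedCell, ← hb, volume_real_interior_convexHull, h] at harea
    simp at harea
  obtain hneg | hpos := hne.lt_or_gt
  · refine ⟨b.reindex (Equiv.swap 1 2), ?_, ?_⟩
    · rw [AffineBasis.coe_reindex, EquivLike.range_comp, hb]
    · rw [cross_anticomm]
      simpa [Equiv.swap_apply_of_ne_of_ne] using hneg
  · exact ⟨b, hb, hpos⟩

/-- The vertices of an element, numbered counterclockwise. -/
def basis : AffineBasis (Fin 3) ℝ Plane := K.exists_affineBasis_cross_pos.choose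

lemma range_basis : range K.basis = K.1 := K.exists_affineBasis_cross_pos.choose_spec.1

lemma basis_mem (i : Fin 3) : K.basis i ∈ K.1 := by
  rw [← Finset.mem_coe, ← K.range_basis]
  exact mem_range_self i

lemma basis_injective : Function.Injective K.basis := K.basis.ind.injective

lemma cell_eq : K.cell = interior (convexHull ℝ (range K.basis)) := by
  rw [K.range_basis, cell, closedCell]

lemma cross_basis_sub_sub (i : Fin 3) :
    cross (K.basis (i + 1) - K.basis i) (K.basis (i + 2) - K.basis i) = 2 * K.area := by
  have harea : cross (K.basis 1 - K.basis 0) (K.basis 2 - K.basis 0) = 2 * K.area := by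
    have hpos : 0 < cross (K.basis 1 - K.basis 0) (K.basis 2 - K.basis 0) :=
      K.exists_affineBasis_cross_pos.choose_spec.2
    rw [area, cell_eq, volume_real_interior_convexHull, abs_of_pos hpos,
      mul_div_cancel₀ _ two_ne_zero]
  rw [← harea]
  fin_cases i <;> simp [cross] <;> ring

/-- The edge opposite to the vertex `K.basis i`. -/
def edge (i : Fin 3) : T.Edge := by
  refine ⟨K.1.erase (K.basis i), T.complex.down_closed K.2.1 (Finset.erase_subset _ _) ?_, ?_⟩
  · rw [← Finset.card_pos, Finset.card_erase_of_mem (K.basis_mem i), K.2.2]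
    exact two_pos
  · rw [Finset.card_erase_of_mem (K.basis_mem i), K.2.2]

lemma edge_eq (i : Fin 3) : (K.edge i).1 = {K.basis (i + 1), K.basis (i + 2)} := by
  refine (Finset.eq_of_subset_of_card_le ?_ ?_).symm
  · simp [edge, Finset.insert_subset_iff, K.basis_mem, K.basis_injective.eq_iff]
  · rw [(K.edge i).2.2, Finset.card_pair (K.basis_injective.ne (by simp))]

lemma edge_injective : Function.Injective K.edge := fun i _ h =>
  K.basis_injective ((Finset.erase_inj _ (K.basis_mem i)).1 (congrArg Subtype.val h))

lemma edge_subset (i : Fin 3) : (K.edge i).1 ⊆ K.1 := Finset.erase_subset _ _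

lemma exists_edge_eq {e : T.Edge} (he : e.1 ⊆ K.1) : ∃ i, K.edge i = e := by
  obtain ⟨x, hx⟩ : ∃ x, K.1 \ e.1 = {x} := Finset.card_eq_one.1 (by
    rw [Finset.card_sdiff_of_subset he, K.2.2, e.2.2])
  have hxK : x ∈ (K.1 : Set Plane) :=
    Finset.mem_coe.2 (Finset.sdiff_subset (hx ▸ Finset.mem_singleton_self x))
  rw [← K.range_basis] at hxK
  obtain ⟨i, rfl⟩ := hxK
  refine ⟨i, Subtype.ext ?_⟩
  change K.1.erase (K.basis i) = e.1
  rw [Finset.erase_eq, ← hx, Finset.sdiff_sdiff_eq_self he]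

lemma edges_eq [DecidableEq T.Edge] : K.edges = Finset.univ.image K.edge := by
  ext e
  simp only [edges, Finset.mem_filter, Finset.mem_univ, true_and, Finset.mem_image]
  exact ⟨K.exists_edge_eq, fun ⟨i, hi⟩ => hi ▸ K.edge_subset i⟩

lemma sum_edges {M : Type*} [AddCommMonoid M] (F : T.Edge → M) :
    ∑ e ∈ K.edges, F e = ∑ i, F (K.edge i) := by
  classical
  rw [edges_eq, Finset.sum_image K.edge_injective.injOn]

end TriangularMesh.Element

end Elements

section Geometry

variable {Ω : Set Plane} {T : TriangularMesh Ω}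

namespace TriangularMesh.Element

variable (K : T.Element)

/-- The barycentre of an element. -/
def centroid : Plane := (3 : ℝ)⁻¹ • ∑ x ∈ K.1, x

/-- The edge vectors of an element, in counterclockwise direction. -/
def tangent (i : Fin 3) : Plane := K.basis (i + 2) - K.basis (i + 1)

/-- The outward normals of an element, scaled to have the length of the edge. -/
def normal (i : Fin 3) : Plane := rot (K.tangent i)

lemma centroid_eq : K.centroid = (3 : ℝ)⁻¹ • ∑ i, K.basis i := by
  have hvertices : K.1 = Finset.univ.image K.basis := by
    rw [← Finset.coe_inj, Finset.coe_image, Finset.coe_univ, image_univ, K.range_basis]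
  rw [centroid, hvertices, Finset.sum_image K.basis_injective.injOn]

lemma coord_centroid (i : Fin 3) : K.basis.coord i K.centroid = 3⁻¹ := by
  rw [centroid_eq, Finset.smul_sum,
    ← Finset.univ.affineCombination_eq_linear_combination K.basis (fun _ => 3⁻¹) (by simp),
    K.basis.coord_apply_combination_of_mem (Finset.mem_univ i) (by simp)]

lemma centroid_mem_cell : K.centroid ∈ K.cell := by
  rw [cell_eq, K.basis.interior_convexHull]
  intro i
  rw [coord_centroid]
  positivity

lemma tangent_add_one (i : Fin 3) : K.tangent (i + 1) = K.basis i - K.basis (i + 2) := by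
  fin_cases i <;> rfl

lemma tangent_add_two (i : Fin 3) : K.tangent (i + 2) = K.basis (i + 1) - K.basis i := by
  fin_cases i <;> rfl

lemma tangent_ne_zero (i : Fin 3) : K.tangent i ≠ 0 :=
  sub_ne_zero.2 (K.basis_injective.ne (by simp))

lemma cross_tangent_tangent (i : Fin 3) :
    cross (K.tangent i) (K.tangent (i + 1)) = 2 * K.area := by
  rw [← K.cross_basis_sub_sub i]
  fin_cases i <;> simp [cross, tangent] <;> ring

lemma norm_normal (i : Fin 3) : ‖K.normal i‖ = ‖K.tangent i‖ := norm_rot _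

lemma norm_normal_pos (i : Fin 3) : 0 < ‖K.normal i‖ := by
  rw [norm_normal, norm_pos_iff]
  exact K.tangent_ne_zero i

lemma sum_normal : ∑ i, K.normal i = 0 := by
  ext j
  fin_cases j <;> simp [Fin.sum_univ_three, normal, rot, tangent]

lemma closedCell_edge (i : Fin 3) :
    (K.edge i).closedCell = segment ℝ (K.basis (i + 1)) (K.basis (i + 2)) := by
  rw [Edge.closedCell, edge_eq, Finset.coe_pair, convexHull_pair]

lemma inner_sub_centroid_normal (i : Fin 3) {x : Plane} (hx : x ∈ (K.edge i).closedCell) :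
    inner ℝ (x - K.centroid) (K.normal i) = 2 * K.area / 3 := by
  rw [closedCell_edge, segment_eq_image_lineMap] at hx
  obtain ⟨s, -, rfl⟩ := hx
  rw [normal, inner_rot_right, centroid_eq, ← K.cross_basis_sub_sub i]
  fin_cases i <;> simp [cross, tangent, AffineMap.lineMap_apply, Fin.sum_univ_three] <;> ring

lemma outwardNormal_edge (i : Fin 3) :
    outwardNormal K (K.edge i) = ‖K.normal i‖⁻¹ • K.normal i := by
  have hne : K.basis (i + 1) ≠ K.basis (i + 2) := K.basis_injective.ne (by simp)
  have hmid : (2 : ℝ)⁻¹ • (K.basis (i + 1) + K.basis (i + 2)) ∈ (K.edge i).closedCell := by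
    rw [closedCell_edge, ← invOf_eq_inv, ← midpoint_eq_smul_add]
    exact midpoint_mem_segment _ _
  have hspan : vectorSpan ℝ ((K.edge i).1 : Set Plane) = Submodule.span ℝ {K.tangent i} := by
    rw [edge_eq, Finset.coe_pair, vectorSpan_pair_rev, vsub_eq_sub, tangent]
  have hpos : 0 < 2 * K.area / 3 / ‖K.tangent i‖ ^ 2 :=
    div_pos (by linarith [K.area_pos]) (pow_pos (norm_pos_iff.2 (K.tangent_ne_zero i)) 2)
  have hcross := K.inner_sub_centroid_normal i hmid
  rw [normal, inner_rot_right] at hcross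
  simp only [outwardNormal, hspan]
  rw [starProjection_orthogonal_span_singleton (K.tangent_ne_zero i), edge_eq,
    Finset.sum_pair hne, ← centroid, hcross, ← normal, norm_smul, Real.norm_of_nonneg hpos.le,
    smul_smul, mul_inv_rev, inv_mul_cancel_right₀ hpos.ne']

lemma integral_edge (i : Fin 3) (r c : ℝ) (a : Plane) :
    ∫ x in (K.edge i).closedCell,
      r * inner ℝ (a + c • (x - K.centroid)) (outwardNormal K (K.edge i))
        ∂(Measure.hausdorffMeasure 1 : Measure Plane) =
      r * (inner ℝ a (K.normal i) + c * (2 * K.area / 3)) := by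
  have hconst : ∀ x ∈ (K.edge i).closedCell,
      r * inner ℝ (a + c • (x - K.centroid)) (outwardNormal K (K.edge i)) =
        ‖K.normal i‖⁻¹ * (r * (inner ℝ a (K.normal i) + c * (2 * K.area / 3))) := fun x hx => by
    rw [outwardNormal_edge, inner_smul_right, inner_add_left, real_inner_smul_left,
      K.inner_sub_centroid_normal i hx, mul_left_comm]
  have hlength : (Measure.hausdorffMeasure 1 : Measure Plane).real (K.edge i).closedCell =
      ‖K.normal i‖ := by
    rw [measureReal_def, closedCell_edge, hausdorffMeasure_segment, edist_dist,
      ENNReal.toReal_ofReal dist_nonneg, norm_normal, tangent, dist_eq_norm']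
  have hmeas : MeasurableSet (K.edge i).closedCell :=
    ((K.edge i).1.finite_toSet.isCompact_convexHull ℝ).measurableSet
  rw [setIntegral_congr_fun hmeas hconst, setIntegral_const, hlength, smul_eq_mul,
    mul_inv_cancel_left₀ (K.norm_normal_pos i).ne']

lemma dist_le_diam {x y : Plane} (hx : x ∈ K.closedCell) (hy : y ∈ K.closedCell) :
    ‖x - y‖ ≤ K.diam := by
  rw [← dist_eq_norm]
  exact Metric.dist_le_diam_of_mem (Element.isCompact K).isBounded hx hy

lemma basis_mem_closedCell (i : Fin 3) : K.basis i ∈ K.closedCell :=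
  subset_convexHull ℝ _ (K.basis_mem i)

lemma norm_tangent_le_diam (i : Fin 3) : ‖K.tangent i‖ ≤ K.diam :=
  K.dist_le_diam (K.basis_mem_closedCell _) (K.basis_mem_closedCell _)

lemma norm_sub_centroid_le_diam {x : Plane} (hx : x ∈ K.cell) : ‖x - K.centroid‖ ≤ K.diam :=
  K.dist_le_diam (interior_subset hx) (interior_subset K.centroid_mem_cell)

/-- The polar moment of inertia of an element about its centroid. -/
def inertia : ℝ := ∫ x in K.cell, ‖x - K.centroid‖ ^ 2

lemma inertia_pos : 0 < K.inertia := by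
  have hint : IntegrableOn (fun x => ‖x - K.centroid‖ ^ 2) K.cell :=
    Element.integrableOn K (by fun_prop)
  refine (setIntegral_pos_iff_support_of_nonneg_ae
    (Filter.Eventually.of_forall fun x => sq_nonneg _) hint).2 ?_
  have hsupport : Function.support (fun x => ‖x - K.centroid‖ ^ 2) = {K.centroid}ᶜ := by
    ext x
    simp [sub_eq_zero]
  rw [hsupport, inter_comm, ← sdiff_eq, measure_sdiff_null (measure_singleton _)]
  exact isOpen_interior.measure_pos volume (Element.cell_nonempty K)

lemma inertia_le : K.inertia ≤ K.diam ^ 2 * K.area := by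
  have h : K.inertia ≤ ∫ _ in K.cell, K.diam ^ 2 := by
    refine setIntegral_mono_on (Element.integrableOn K (by fun_prop))
      (Element.integrableOn K (by fun_prop)) isOpen_interior.measurableSet fun x hx => ?_
    gcongr
    exact K.norm_sub_centroid_le_diam hx
  rwa [setIntegral_const, smul_eq_mul, mul_comm] at h


lemma integral_inner_sub_centroid (a : Plane) :
    ∫ x in K.cell, inner ℝ a (x - K.centroid) = 0 := by
  have hcombination : ∀ x, inner ℝ a (x - K.centroid) =
      ∑ i, (K.basis.coord i x - 3⁻¹) * inner ℝ a (K.basis i) := fun x => by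
    nth_rw 1 [← K.basis.linear_combination_coord_eq_self x]
    rw [centroid_eq, Finset.smul_sum, ← Finset.sum_sub_distrib, inner_sum]
    refine Finset.sum_congr rfl fun i _ => ?_
    rw [← sub_smul, real_inner_smul_right]
  have hcoord : ∀ i, ∫ x in K.cell, (K.basis.coord i x - 3⁻¹) = 0 := fun i => by
    rw [integral_sub (Element.integrableOn K (K.basis.coord i).continuous_of_finiteDimensional)
      (Element.integrableOn K continuous_const), setIntegral_const, cell_eq, setIntegral_coord]
    simp [div_eq_mul_inv]
  simp only [hcombination]
  rw [integral_finsetSum _ fun i _ => Element.integrableOn K (by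
    have := (K.basis.coord i).continuous_of_finiteDimensional
    fun_prop)]
  simp only [integral_mul_const, hcoord, zero_mul, Finset.sum_const_zero]

lemma integral_inner_affine (a b : Plane) (c d : ℝ) :
    ∫ x in K.cell, inner ℝ (a + c • (x - K.centroid)) (b + d • (x - K.centroid)) =
      K.area * inner ℝ a b + c * d * K.inertia := by
  have hexpand : ∀ x, inner ℝ (a + c • (x - K.centroid)) (b + d • (x - K.centroid)) =
      inner ℝ a b + inner ℝ (d • a + c • b) (x - K.centroid) + c * d * ‖x - K.centroid‖ ^ 2 :=
    fun x => by
      simp only [inner_add_left, inner_add_right, real_inner_smul_left, real_inner_smul_right,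
        real_inner_self_eq_norm_sq, real_inner_comm b (x - K.centroid)]
      ring
  have hint (g : Plane → ℝ) (hg : Continuous g) := Element.integrableOn K hg
  simp only [hexpand]
  rw [integral_add (hint _ (by fun_prop)) (hint _ (by fun_prop)),
    integral_add (hint _ (by fun_prop)) (hint _ (by fun_prop)), integral_inner_sub_centroid,
    integral_const_mul, setIntegral_const, add_zero, smul_eq_mul, area, inertia]

end TriangularMesh.Element

end Geometry

section WeakGradient

variable {Ω : Set Plane} {T : TriangularMesh Ω}

lemma divergence_affine (a : Plane) (c : ℝ) (x₀ x : Plane) :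
    divergence (fun x => a + c • (x - x₀)) x = 2 * c := by
  have h : HasFDerivAt (fun x : Plane => a + c • (x - x₀))
      (c • ContinuousLinearMap.id ℝ Plane) x :=
    (((hasFDerivAt_id x).sub_const x₀).const_smul c).const_add a
  simp [divergence, h.fderiv]

lemma mem_RT0_iff_exists_sub (x₀ : Plane) {q : Plane → Plane} :
    q ∈ RT0 ↔ ∃ (a : Plane) (c : ℝ), q = fun x => a + c • (x - x₀) := by
  constructor
  · rintro ⟨a, c, h⟩
    exact ⟨a + c • x₀, c, funext fun x => by rw [h, smul_sub]; abel⟩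
  · rintro ⟨a, c, rfl⟩
    exact ⟨a - c • x₀, c, fun x => by simp only [smul_sub]; abel⟩

namespace DiscreteFunction

variable (v : DiscreteFunction T) (K : T.Element)

/-- The gradient on an element of the nonconforming affine interpolant of the edge values; it is the
mean of the weak gradient. -/
def grad : Plane := K.area⁻¹ • ∑ i, v.edge (K.edge i) • K.normal i

/-- The mean of the three edge values on an element. -/
def edgeMean : ℝ := (∑ i, v.edge (K.edge i)) / 3

/-- The coefficient of the radial field `x - K.centroid` in the weak gradient. -/
def slope : ℝ := 2 * K.area * (v.edgeMean K - v.elem K) / K.inertia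

theorem weakGradient_eq :
    weakGradient v K = fun x => v.grad K + v.slope K • (x - K.centroid) := by
  refine (existsUnique_isWeakGradient v K).unique
    (existsUnique_isWeakGradient v K).exists.choose_spec
    ⟨(mem_RT0_iff_exists_sub K.centroid).2 ⟨_, _, rfl⟩, fun q hq => ?_⟩
  obtain ⟨b, d, rfl⟩ := (mem_RT0_iff_exists_sub K.centroid).1 hq
  have hgrad : K.area * inner ℝ (v.grad K) b = ∑ i, v.edge (K.edge i) * inner ℝ b (K.normal i) := by
    rw [grad, real_inner_smul_left, mul_inv_cancel_left₀ K.area_pos.ne', real_inner_comm, inner_sum]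
    simp only [real_inner_smul_right]
  have hslope : v.slope K * K.inertia = 2 * K.area * (v.edgeMean K - v.elem K) :=
    div_mul_cancel₀ _ K.inertia_pos.ne'
  simp only [divergence_affine]
  rw [K.integral_inner_affine, K.sum_edges, hgrad, mul_right_comm, hslope, edgeMean,
    setIntegral_const, ← TriangularMesh.Element.area, smul_eq_mul]
  simp only [K.integral_edge, mul_add, Finset.sum_add_distrib, ← Finset.sum_mul]
  ring

lemma inner_tangent_grad (k : Fin 3) : inner ℝ (K.tangent k) (v.grad K) =
    2 * (v.edge (K.edge (k + 1)) - v.edge (K.edge (k + 2))) := by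
  have hprev : cross (K.tangent k) (K.tangent (k + 2)) = -(2 * K.area) := by
    rw [cross_anticomm, ← K.cross_tangent_tangent (k + 2), add_assoc]
    simp
  rw [grad, ← Equiv.sum_comp (Equiv.addLeft k), Fin.sum_univ_three, real_inner_smul_right]
  simp only [Equiv.coe_addLeft, inner_add_right, real_inner_smul_right,
    TriangularMesh.Element.normal, inner_rot_right, add_zero, cross_self,
    K.cross_tangent_tangent k, hprev]
  have harea := K.area_pos
  field_simp
  ring

lemma edge_eq_of_grad_eq_zero (h : v.grad K = 0) (i j : Fin 3) :
    v.edge (K.edge i) = v.edge (K.edge j) := by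
  have hcyclic : ∀ k, v.edge (K.edge (k + 1)) = v.edge (K.edge (k + 2)) := fun k => by
    have hk := v.inner_tangent_grad K k
    rw [h, inner_zero_right] at hk
    linarith
  have h₁₂ : v.edge (K.edge 1) = v.edge (K.edge 2) := hcyclic 0
  have h₂₀ : v.edge (K.edge 2) = v.edge (K.edge 0) := hcyclic 1
  fin_cases i <;> fin_cases j <;> simp [h₁₂, h₂₀]

end DiscreteFunction

end WeakGradient

section Diffusion

variable {Ω : Set Plane} {T : TriangularMesh Ω}

@[fun_prop]
lemma continuous_matForm {X : Type*} [TopologicalSpace X] {B : X → Matrix (Fin 2) (Fin 2) ℝ}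
    {u v : X → Plane} (hB : Continuous B) (hu : Continuous u) (hv : Continuous v) :
    Continuous fun x => matForm (B x) (u x) (v x) := by
  unfold matForm
  fun_prop

/-- The matrix field `A` is, on the set `s`, symmetric, uniformly elliptic with constant `c` and
Lipschitz continuous with constant `L`. -/
structure IsDiffusionOn (A : Plane → Matrix (Fin 2) (Fin 2) ℝ) (s : Set Plane) (c L : ℝ) :
    Prop where
  symm : ∀ x ∈ s, (A x).IsSymm
  pos : 0 < c
  elliptic : ∀ x ∈ s, IsElliptic c (A x)
  lipschitz : ∀ x ∈ s, ∀ y ∈ s, ‖A x - A y‖ ≤ L * ‖x - y‖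

namespace IsDiffusionOn

variable {A : Plane → Matrix (Fin 2) (Fin 2) ℝ} {K : T.Element} {c L : ℝ}

lemma lipschitz_nonneg (h : IsDiffusionOn A K.cell c L) : 0 ≤ L := by
  obtain ⟨x, hx, hne⟩ : ∃ x ∈ K.cell, x ≠ K.centroid := by
    by_contra! hall
    exact (isOpen_interior.measure_pos volume (Element.cell_nonempty K)).ne'
      (measure_mono_null (t := {K.centroid}) hall (measure_singleton _))
  exact nonneg_of_mul_nonneg_left
    ((norm_nonneg _).trans (h.lipschitz x hx _ K.centroid_mem_cell))
    (norm_pos_iff.2 (sub_ne_zero.2 hne))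

lemma exists_continuous_eqOn (h : IsDiffusionOn A K.cell c L) :
    ∃ G : Plane → Matrix (Fin 2) (Fin 2) ℝ, Continuous G ∧ EqOn A G K.cell := by
  have hlip : LipschitzOnWith L.toNNReal A K.cell :=
    LipschitzOnWith.of_dist_le_mul fun x hx y hy => by
      rw [Real.coe_toNNReal _ h.lipschitz_nonneg, dist_eq_norm, dist_eq_norm]
      exact h.lipschitz x hx y hy
  obtain ⟨G, hG, hAG⟩ := hlip.extend_finite_dimension
  exact ⟨G, hG.continuous, hAG⟩

lemma integrableOn {E : Type*} [NormedAddCommGroup E] (h : IsDiffusionOn A K.cell c L)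
    {F : Plane × Matrix (Fin 2) (Fin 2) ℝ → E} (hF : Continuous F) :
    IntegrableOn (fun x => F (x, A x)) K.cell := by
  obtain ⟨G, hG, hAG⟩ := h.exists_continuous_eqOn
  have hFG : Continuous fun x => F (x, G x) := by fun_prop
  refine ((hFG.continuousOn.integrableOn_compact (Element.isCompact K)).mono_set
    interior_subset).congr_fun (fun x hx => ?_) isOpen_interior.measurableSet
  simp only [hAG hx]

lemma integrableOn_matForm (h : IsDiffusionOn A K.cell c L) {p q : Plane → Plane}
    (hp : Continuous p) (hq : Continuous q) :
    IntegrableOn (fun x => matForm (A x) (p x) (q x)) K.cell :=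
  h.integrableOn (F := fun z => matForm z.2 (p z.1) (q z.1)) (by fun_prop)

lemma isSymm_average (h : IsDiffusionOn A K.cell c L) : (average A K).IsSymm := by
  ext i j
  simp only [Matrix.transpose_apply, average, Matrix.of_apply, setAverage_eq]
  congr 1
  exact setIntegral_congr_fun isOpen_interior.measurableSet fun x hx => (h.symm x hx).apply i j

lemma integral_matForm (h : IsDiffusionOn A K.cell c L) (a b : Plane) :
    ∫ x in K.cell, matForm (A x) a b = K.area * matForm (average A K) a b := by
  have hentry (i j : Fin 2) : ∫ x in K.cell, A x i j = K.area * average A K i j := by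
    rw [average, Matrix.of_apply, setAverage_eq, smul_eq_mul, ← TriangularMesh.Element.area,
      mul_inv_cancel_left₀ K.area_pos.ne']
  have hint (i j : Fin 2) : IntegrableOn (fun x => a i * (A x i j * b j)) K.cell :=
    h.integrableOn (F := fun z => a i * (z.2 i j * b j)) (by fun_prop)
  simp only [matForm, dotProduct, Matrix.mulVec, Finset.mul_sum]
  rw [integral_finsetSum _ fun i _ => integrable_finsetSum _ fun j _ => hint i j]
  refine Finset.sum_congr rfl fun i _ => ?_
  rw [integral_finsetSum _ fun j _ => hint i j]
  refine Finset.sum_congr rfl fun j _ => ?_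
  rw [integral_const_mul, integral_mul_const, hentry]
  ring

lemma setIntegral_matForm_ge (h : IsDiffusionOn A K.cell c L) (a : Plane) (r : ℝ) :
    c * (K.area * ‖a‖ ^ 2 + r ^ 2 * K.inertia) ≤
      ∫ x in K.cell, matForm (A x) (a + r • (x - K.centroid)) (a + r • (x - K.centroid)) := by
  have hcont : Continuous fun x => a + r • (x - K.centroid) := by fun_prop
  rw [← real_inner_self_eq_norm_sq, pow_two, ← K.integral_inner_affine, ← integral_const_mul]
  refine setIntegral_mono_on ((Element.integrableOn K (hcont.inner hcont)).const_mul c)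
    (h.integrableOn_matForm hcont hcont) isOpen_interior.measurableSet fun x hx => ?_
  rw [real_inner_self_eq_norm_sq]
  exact h.elliptic x hx _

lemma isElliptic_average (h : IsDiffusionOn A K.cell c L) : IsElliptic c (average A K) :=
  fun ξ => by
    have hξ := h.setIntegral_matForm_ge ξ 0
    simp only [zero_smul, add_zero] at hξ
    rw [h.integral_matForm] at hξ
    refine le_of_mul_le_mul_left ?_ K.area_pos
    linarith

end IsDiffusionOn

end Diffusion

section SchurComplement

variable {Ω : Set Plane} {T : TriangularMesh Ω}

namespace TriangularMesh.Element

variable (K : T.Element) (A : Plane → Matrix (Fin 2) (Fin 2) ℝ)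

/-- The first moment `∫ A x (x - x_K)` of the diffusion matrix about the centroid `x_K`. -/
def moment : Plane := ∫ x in K.cell, WithLp.toLp 2 ((A x).mulVec (x - K.centroid).ofLp)

/-- The second moment `∫ (x - x_K)ᵀ A x (x - x_K)`, which is the energy of the radial part of the
weak gradient. -/
def energy : ℝ := ∫ x in K.cell, matForm (A x) (x - K.centroid) (x - K.centroid)

/-- The energy of the mean gradient once the element value is eliminated: the Schur complement of
the radial part in the local energy matrix. -/
def schur : Matrix (Fin 2) (Fin 2) ℝ :=
  K.area • average A K - (K.energy A)⁻¹ • Matrix.vecMulVec (K.moment A).ofLp (K.moment A).ofLp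

/-- The weight of the value on the edge `i` in the element value obtained by local elimination. -/
def weight (i : Fin 3) : ℝ :=
  1 / 3 + K.inertia * inner ℝ (K.normal i) (K.moment A) / (2 * K.area ^ 2 * K.energy A)

lemma matForm_schur (a b : Plane) : matForm (K.schur A) a b =
    K.area * matForm (average A K) a b -
      inner ℝ a (K.moment A) * inner ℝ b (K.moment A) / K.energy A := by
  simp only [matForm, schur, inner_eq_add, Matrix.vecMulVec, dotProduct, Matrix.mulVec,
    Fin.sum_univ_two, Matrix.sub_apply, Matrix.smul_apply, Matrix.of_apply, smul_eq_mul]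
  ring

lemma sum_weight : ∑ i, K.weight A i = 1 := by
  simp only [weight, Finset.sum_add_distrib, ← Finset.sum_div, ← Finset.mul_sum, ← sum_inner,
    K.sum_normal, inner_zero_left]
  simp

end TriangularMesh.Element

namespace IsDiffusionOn

variable {A : Plane → Matrix (Fin 2) (Fin 2) ℝ} {K : T.Element} {c L : ℝ}

lemma inner_moment (h : IsDiffusionOn A K.cell c L) (a : Plane) :
    inner ℝ a (K.moment A) = ∫ x in K.cell, matForm (A x) a (x - K.centroid) := by
  have hint : IntegrableOn (fun x => (WithLp.toLp 2 ((A x).mulVec (x - K.centroid).ofLp) : Plane))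
      K.cell :=
    h.integrableOn (F := fun z => WithLp.toLp 2 (z.2.mulVec (z.1 - K.centroid).ofLp)) (by fun_prop)
  rw [TriangularMesh.Element.moment, ← integral_inner hint]
  simp only [matForm_eq_inner]
  rfl

lemma integral_matForm_affine (h : IsDiffusionOn A K.cell c L) (a b : Plane) (r s : ℝ) :
    ∫ x in K.cell, matForm (A x) (a + r • (x - K.centroid)) (b + s • (x - K.centroid)) =
      K.area * matForm (average A K) a b + s * inner ℝ a (K.moment A) +
        r * inner ℝ b (K.moment A) + r * s * K.energy A := by
  have hconst (a b : Plane) : IntegrableOn (fun x => matForm (A x) a b) K.cell :=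
    h.integrableOn_matForm continuous_const continuous_const
  have hmixed (a : Plane) (s : ℝ) :
      IntegrableOn (fun x => s * matForm (A x) a (x - K.centroid)) K.cell :=
    (h.integrableOn_matForm continuous_const (by fun_prop)).const_mul s
  have hradial :
      IntegrableOn (fun x => r * s * matForm (A x) (x - K.centroid) (x - K.centroid)) K.cell :=
    (h.integrableOn_matForm (by fun_prop) (by fun_prop)).const_mul (r * s)
  have hexpand (x : Plane) (hx : x ∈ K.cell) :
      matForm (A x) (a + r • (x - K.centroid)) (b + s • (x - K.centroid)) =
        matForm (A x) a b + s * matForm (A x) a (x - K.centroid) +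
          r * matForm (A x) b (x - K.centroid) +
            r * s * matForm (A x) (x - K.centroid) (x - K.centroid) := by
    rw [matForm_comm (h.symm x hx) b]
    simp only [← matBilin_apply, map_add, map_smul, LinearMap.add_apply, LinearMap.smul_apply,
      smul_eq_mul]
    ring
  rw [setIntegral_congr_fun (s := K.cell) isOpen_interior.measurableSet hexpand,
    integral_add ?_ hradial, integral_add ?_ (hmixed b r), integral_add (hconst a b) (hmixed a s)]
  · simp only [integral_const_mul, h.integral_matForm, h.inner_moment,
      TriangularMesh.Element.energy]
  · exact (hconst a b).add (hmixed a s)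
  · exact ((hconst a b).add (hmixed a s)).add (hmixed b r)

lemma mul_inertia_le_energy (h : IsDiffusionOn A K.cell c L) : c * K.inertia ≤ K.energy A := by
  simpa [TriangularMesh.Element.energy] using h.setIntegral_matForm_ge 0 1

lemma energy_pos (h : IsDiffusionOn A K.cell c L) : 0 < K.energy A :=
  (mul_pos h.pos K.inertia_pos).trans_le h.mul_inertia_le_energy

/-- The Schur complement is the minimum of the energy over the radial part. -/
lemma matForm_schur_self_ge (h : IsDiffusionOn A K.cell c L) (a : Plane) :
    c * (K.area * ‖a‖ ^ 2) ≤ matForm (K.schur A) a a := by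
  have henergy := h.energy_pos.ne'
  set r := -(inner ℝ a (K.moment A) / K.energy A) with hr
  calc c * (K.area * ‖a‖ ^ 2) ≤ c * (K.area * ‖a‖ ^ 2 + r ^ 2 * K.inertia) :=
        mul_le_mul_of_nonneg_left
          (le_add_of_nonneg_right (mul_nonneg (sq_nonneg r) K.inertia_pos.le)) h.pos.le
    _ ≤ K.area * matForm (average A K) a a + r * inner ℝ a (K.moment A) +
          r * inner ℝ a (K.moment A) + r * r * K.energy A := by
        rw [← h.integral_matForm_affine]
        exact h.setIntegral_matForm_ge a r
    _ = matForm (K.schur A) a a := by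
        rw [K.matForm_schur, hr]
        field_simp
        ring

/-- Only the oscillation of the coefficient enters, because `x - K.centroid` has mean zero. -/
lemma abs_inner_moment_le (h : IsDiffusionOn A K.cell c L) (a : Plane) :
    |inner ℝ a (K.moment A)| ≤ L * K.inertia * ‖a‖ := by
  have hmean : ∫ x in K.cell, matForm (A K.centroid) a (x - K.centroid) = 0 := by
    simp only [matForm_eq_inner, ← ContinuousLinearMap.adjoint_inner_left,
      K.integral_inner_sub_centroid]
  have hA : IntegrableOn (fun x => matForm (A x) a (x - K.centroid)) K.cell :=
    h.integrableOn_matForm continuous_const (by fun_prop)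
  have hA₀ : IntegrableOn (fun x => matForm (A K.centroid) a (x - K.centroid)) K.cell :=
    Element.integrableOn K (by fun_prop)
  have hosc (x : Plane) (hx : x ∈ K.cell) :
      ‖matForm (A x) a (x - K.centroid) - matForm (A K.centroid) a (x - K.centroid)‖ ≤
        L * ‖a‖ * ‖x - K.centroid‖ ^ 2 := by
    calc _ = |matForm (A x - A K.centroid) a (x - K.centroid)| := by
          rw [Real.norm_eq_abs]
          simp only [matForm, Matrix.sub_mulVec, dotProduct_sub]
      _ ≤ ‖A x - A K.centroid‖ * ‖a‖ * ‖x - K.centroid‖ := abs_matForm_le _ _ _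
      _ ≤ L * ‖x - K.centroid‖ * ‖a‖ * ‖x - K.centroid‖ := by
          gcongr
          exact h.lipschitz x hx _ K.centroid_mem_cell
      _ = L * ‖a‖ * ‖x - K.centroid‖ ^ 2 := by ring
  rw [h.inner_moment, ← sub_zero (∫ x in K.cell, _), ← hmean, ← integral_sub hA hA₀]
  calc _ ≤ ∫ x in K.cell, L * ‖a‖ * ‖x - K.centroid‖ ^ 2 :=
        norm_integral_le_of_norm_le (Element.integrableOn K (by fun_prop))
          (ae_restrict_of_forall_mem isOpen_interior.measurableSet hosc)
    _ = L * K.inertia * ‖a‖ := by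
        rw [integral_const_mul, TriangularMesh.Element.inertia]
        ring

lemma abs_inner_moment_mul_div_energy_le (h : IsDiffusionOn A K.cell c L) (a b : Plane) :
    |inner ℝ a (K.moment A) * inner ℝ b (K.moment A)| / K.energy A ≤
      K.area * (L ^ 2 * K.diam ^ 2 / c * (‖a‖ * ‖b‖)) := by
  have hc := h.pos
  have hinertia := K.inertia_pos
  have hL := h.lipschitz_nonneg
  rw [abs_mul]
  calc _ ≤ L * K.inertia * ‖a‖ * (L * K.inertia * ‖b‖) / (c * K.inertia) := by
        gcongr
        · exact h.abs_inner_moment_le a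
        · exact h.abs_inner_moment_le b
        · exact h.mul_inertia_le_energy
    _ = L ^ 2 * (‖a‖ * ‖b‖) / c * K.inertia := by field_simp
    _ ≤ L ^ 2 * (‖a‖ * ‖b‖) / c * (K.diam ^ 2 * K.area) := by
        gcongr
        exact K.inertia_le
    _ = _ := by ring

lemma le_neg_matForm_average_normal (h : IsDiffusionOn A K.cell c L) (k : Fin 3) {κ : ℝ}
    (hκ : 0 ≤ κ)
    (hangle : κ ≤ cosAngle (average A K)⁻¹ (K.basis k) (K.basis (k + 2)) (K.basis (k + 1))) :
    κ * c * (‖K.normal (k + 1)‖ * ‖K.normal (k + 2)‖) ≤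
      -matForm (average A K) (K.normal (k + 1)) (K.normal (k + 2)) := by
  have hne (j : Fin 3) (hj : j ≠ 0) : K.basis (k + j) ≠ K.basis k :=
    K.basis_injective.ne (by simpa using hj)
  have hrot := h.isElliptic_average.le_matForm_rot h.pos h.isSymm_average hκ
    (hne 2 (by decide)) (hne 1 (by decide)) hangle
  have hneg (u : Plane) : rot (-u) = -rot u := by ext i; fin_cases i <;> simp [rot]
  rwa [← neg_sub (K.basis k), ← K.tangent_add_one, ← K.tangent_add_two, norm_neg, hneg,
    ← matBilin_apply, map_neg, LinearMap.neg_apply, ← K.norm_normal, ← K.norm_normal] at hrot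

lemma schur_normal_add_one_add_two_nonpos (h : IsDiffusionOn A K.cell c L) (k : Fin 3)
    (hangle : L ^ 2 * K.diam ^ 2 / c ^ 2 ≤
      cosAngle (average A K)⁻¹ (K.basis k) (K.basis (k + 2)) (K.basis (k + 1))) :
    matForm (K.schur A) (K.normal (k + 1)) (K.normal (k + 2)) ≤ 0 := by
  have hmoment := h.abs_inner_moment_mul_div_energy_le (K.normal (k + 1)) (K.normal (k + 2))
  have haverage := h.le_neg_matForm_average_normal k (by positivity) hangle
  have hκ : L ^ 2 * K.diam ^ 2 / c ^ 2 * c = L ^ 2 * K.diam ^ 2 / c := by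
    have := h.pos.ne'
    field_simp
  rw [hκ] at haverage
  have hneg := div_le_div_of_nonneg_right
    (neg_le_abs (inner ℝ (K.normal (k + 1)) (K.moment A) *
      inner ℝ (K.normal (k + 2)) (K.moment A))) h.energy_pos.le
  rw [neg_div] at hneg
  rw [K.matForm_schur]
  linarith [mul_le_mul_of_nonneg_left haverage K.area_pos.le]

lemma isSymm_schur (h : IsDiffusionOn A K.cell c L) : (K.schur A).IsSymm :=
  (h.isSymm_average.smul K.area).sub
    (Matrix.IsSymm.smul (Matrix.transpose_vecMulVec _ _) (K.energy A)⁻¹)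

lemma schur_normal_nonpos (h : IsDiffusionOn A K.cell c L)
    (hangle : ∀ p ∈ K.1, ∀ q ∈ K.1, ∀ r ∈ K.1, p ≠ q → p ≠ r → q ≠ r →
      L ^ 2 * K.diam ^ 2 / c ^ 2 ≤ cosAngle (average A K)⁻¹ p q r) {i j : Fin 3} (hij : i ≠ j) :
    matForm (K.schur A) (K.normal i) (K.normal j) ≤ 0 := by
  have hcyclic (k : Fin 3) : matForm (K.schur A) (K.normal (k + 1)) (K.normal (k + 2)) ≤ 0 :=
    h.schur_normal_add_one_add_two_nonpos k
      (hangle _ (K.basis_mem _) _ (K.basis_mem _) _ (K.basis_mem _)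
        (K.basis_injective.ne (by simp)) (K.basis_injective.ne (by simp))
        (K.basis_injective.ne (by simp)))
  obtain ⟨k, ⟨rfl, rfl⟩ | ⟨rfl, rfl⟩⟩ :
      ∃ k, i = k + 1 ∧ j = k + 2 ∨ i = k + 2 ∧ j = k + 1 := by
    revert i j
    decide
  · exact hcyclic k
  · rw [matForm_comm h.isSymm_schur]
    exact hcyclic k

lemma weight_nonneg (h : IsDiffusionOn A K.cell c L)
    (hshape : 0 < L → K.diam ^ 3 / K.area ≤ 2 * c / (3 * L)) (i : Fin 3) :
    0 ≤ K.weight A i := by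
  have hc := h.pos
  have hinertia := K.inertia_pos
  have harea := K.area_pos
  have hL := h.lipschitz_nonneg
  have hmoment : -inner ℝ (K.normal i) (K.moment A) ≤ L * K.inertia * K.diam :=
    calc _ ≤ L * K.inertia * ‖K.normal i‖ := (neg_le_abs _).trans (h.abs_inner_moment_le _)
      _ ≤ L * K.inertia * K.diam := by
          rw [K.norm_normal]
          gcongr
          exact K.norm_tangent_le_diam i
  have hratio : L * (K.diam ^ 3 / K.area) / (2 * c) ≤ 1 / 3 := by
    rcases hL.eq_or_lt with rfl | hL'
    · simp
    · calc _ ≤ L * (2 * c / (3 * L)) / (2 * c) :=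
            div_le_div_of_nonneg_right (mul_le_mul_of_nonneg_left (hshape hL') hL) (by positivity)
        _ = 1 / 3 := by field_simp
  have hcorrection : -(K.inertia * inner ℝ (K.normal i) (K.moment A) /
      (2 * K.area ^ 2 * K.energy A)) ≤ L * (K.diam ^ 3 / K.area) / (2 * c) := by
    have hdiam : 0 ≤ K.diam := Metric.diam_nonneg
    calc _ = K.inertia * -inner ℝ (K.normal i) (K.moment A) /
            (2 * K.area ^ 2 * K.energy A) := by ring
      _ ≤ K.inertia * (L * K.inertia * K.diam) / (2 * K.area ^ 2 * (c * K.inertia)) := by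
          gcongr
          exact h.mul_inertia_le_energy
      _ = L * K.diam / (2 * K.area ^ 2 * c) * K.inertia := by field_simp
      _ ≤ L * K.diam / (2 * K.area ^ 2 * c) * (K.diam ^ 2 * K.area) := by
          gcongr
          exact K.inertia_le
      _ = _ := by field_simp
  rw [TriangularMesh.Element.weight]
  linarith

end IsDiffusionOn

end SchurComplement

section LocalElimination

variable {Ω : Set Plane} {T : TriangularMesh Ω} {A : Plane → Matrix (Fin 2) (Fin 2) ℝ}

lemma IsDiffusionOn.integral_matForm_weakGradient {K : T.Element} {c L : ℝ}
    (h : IsDiffusionOn A K.cell c L) (v u : DiscreteFunction T) :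
    ∫ x in K.cell, matForm (A x) (weakGradient v K x) (weakGradient u K x) =
      K.area * matForm (average A K) (v.grad K) (u.grad K) +
        u.slope K * inner ℝ (v.grad K) (K.moment A) +
        v.slope K * inner ℝ (u.grad K) (K.moment A) + v.slope K * u.slope K * K.energy A := by
  rw [v.weakGradient_eq, u.weakGradient_eq, ← h.integral_matForm_affine]

lemma DiscreteFunction.sum_edge_mul_weight (v : DiscreteFunction T) (K : T.Element) :
    ∑ i, v.edge (K.edge i) * K.weight A i =
      v.edgeMean K +
        K.inertia / (2 * K.area * K.energy A) * inner ℝ (v.grad K) (K.moment A) := by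
  have harea := K.area_pos.ne'
  simp only [edgeMean, grad, TriangularMesh.Element.weight, Fin.sum_univ_three, inner_add_left,
    real_inner_smul_left]
  field_simp
  ring

namespace IsWeakGalerkinSolution

variable {f : Plane → ℝ} {g : {e : T.Edge // e.IsBoundary} → ℝ} {u : DiscreteFunction T}
  {c L : T.Element → ℝ}

lemma slope_mul_energy (hu : IsWeakGalerkinSolution T A f g u)
    (hA : ∀ K : T.Element, IsDiffusionOn A K.cell (c K) (L K)) (K : T.Element) :
    u.slope K * K.energy A = -inner ℝ (u.grad K) (K.moment A) -
      K.inertia / (2 * K.area) * ∫ x in K.cell, f x := by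
  classical
  let bump : DiscreteFunction T := ⟨Pi.single K 1, 0⟩
  have hgrad (K' : T.Element) : bump.grad K' = 0 := by simp [DiscreteFunction.grad, bump]
  have hslope (K' : T.Element) :
      bump.slope K' = (Pi.single K (-(2 * K.area / K.inertia)) : T.Element → ℝ) K' := by
    rcases eq_or_ne K' K with rfl | hne
    · simp [DiscreteFunction.slope, DiscreteFunction.edgeMean, bump, neg_div]
    · simp [DiscreteFunction.slope, DiscreteFunction.edgeMean, bump, hne]
  have htest := hu.2 bump fun e _ => rfl
  simp only [(hA _).integral_matForm_weakGradient, hgrad, hslope, integral_mul_const] at htest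
  simp only [← matBilin_apply, map_zero, LinearMap.zero_apply, inner_zero_left, mul_zero,
    zero_add] at htest
  rw [Fintype.sum_eq_single K fun K' hne => by simp [hne],
    Fintype.sum_eq_single K fun K' hne => by simp [bump, hne]] at htest
  simp only [Pi.single_eq_same, bump, mul_one] at htest
  have harea := K.area_pos
  have hinertia := K.inertia_pos
  rw [← htest]
  field_simp
  ring

lemma elem_eq (hu : IsWeakGalerkinSolution T A f g u)
    (hA : ∀ K : T.Element, IsDiffusionOn A K.cell (c K) (L K)) (K : T.Element) :
    u.elem K = ∑ i, u.edge (K.edge i) * K.weight A i +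
      K.inertia ^ 2 / (4 * K.area ^ 2 * K.energy A) * ∫ x in K.cell, f x := by
  have henergy := (hA K).energy_pos
  have hinertia := K.inertia_pos
  have harea := K.area_pos
  have hslope := hu.slope_mul_energy hA K
  rw [DiscreteFunction.slope] at hslope
  rw [u.sum_edge_mul_weight]
  field_simp at hslope ⊢
  linear_combination -2 * hslope

/-- Testing with the function of slope zero that has the edge values of `v` eliminates the element
values of `u` from the discrete equations. -/
lemma sum_matForm_schur (hu : IsWeakGalerkinSolution T A f g u)
    (hA : ∀ K : T.Element, IsDiffusionOn A K.cell (c K) (L K)) {v : DiscreteFunction T}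
    (hv : ∀ e : T.Edge, e.IsBoundary → v.edge e = 0) :
    ∑ K, matForm (TriangularMesh.Element.schur K A) (v.grad K) (u.grad K) =
      ∑ K : T.Element, (∑ i, v.edge (K.edge i) * K.weight A i) * ∫ x in K.cell, f x := by
  let w : DiscreteFunction T := ⟨v.edgeMean, v.edge⟩
  have hgrad (K : T.Element) : w.grad K = v.grad K := rfl
  have hslope (K : T.Element) : w.slope K = 0 := by
    simp [DiscreteFunction.slope, w, DiscreteFunction.edgeMean]
  have htest := hu.2 w hv
  rw [← sub_eq_zero, ← Finset.sum_sub_distrib] at htest ⊢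
  refine Eq.trans (Finset.sum_congr rfl fun K _ => ?_) htest
  have henergy := (hA K).energy_pos
  have harea := K.area_pos
  have hslope_u := hu.slope_mul_energy hA K
  rw [← eq_div_iff henergy.ne'] at hslope_u
  rw [(hA K).integral_matForm_weakGradient, hgrad, hslope, hslope_u, K.matForm_schur,
    v.sum_edge_mul_weight, integral_mul_const]
  simp only [w]
  field_simp
  ring

end IsWeakGalerkinSolution

end LocalElimination

section Mesh

variable {Ω : Set Plane} {T : TriangularMesh Ω}

lemma TriangularMesh.isOpen_domain (T : TriangularMesh Ω) : IsOpen Ω := by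
  rw [T.domain_eq]
  exact isOpen_interior

lemma TriangularMesh.Element.cell_subset_domain (K : T.Element) : K.cell ⊆ Ω :=
  (interior_mono (T.complex.convexHull_subset_space K.2.1)).trans T.domain_eq.ge

lemma TriangularMesh.Element.closedCell_subset_closure_domain (K : T.Element) :
    K.closedCell ⊆ closure Ω := by
  have hclosure : closure K.cell = closure K.closedCell :=
    (convex_convexHull ℝ _).closure_interior_eq_closure_of_nonempty_interior
      (Element.cell_nonempty K)
  exact subset_closure.trans (hclosure ▸ closure_mono K.cell_subset_domain)

lemma TriangularMesh.exists_element_mem_closedCell (T : TriangularMesh Ω) {x : Plane} (hx : x ∈ Ω) :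
    ∃ K : T.Element, x ∈ K.closedCell := by
  rw [T.domain_eq] at hx
  obtain ⟨s, hs, hxs⟩ := T.complex.mem_space_iff.1 (interior_subset hx)
  obtain ⟨K, hK, hcard, hsK⟩ := T.pure s hs
  exact ⟨⟨K, hK, hcard⟩, convexHull_mono hsK hxs⟩

lemma TriangularMesh.Element.cell_eq_openSimplex (K : T.Element) : K.cell = openSimplex ℝ K.1 :=
  interior_convexHull_eq_openSimplex K.affineIndependent K.affineSpan_eq_top

lemma TriangularMesh.Edge.cell_eq_openSimplex (e : T.Edge) : e.cell = openSimplex ℝ e.1 :=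
  (openSimplex_eq_diff_of_card_eq_two e.2.2).symm

lemma TriangularMesh.exists_mem_cell (T : TriangularMesh Ω) {x : Plane} (hx : x ∈ Ω)
    (hvertex : x ∉ T.complex.vertices) :
    (∃ K : T.Element, x ∈ K.cell) ∨ ∃ e : T.Edge, x ∈ e.cell := by
  rw [T.domain_eq] at hx
  obtain ⟨s, hs, hxs⟩ := exists_face_mem_openSimplex (interior_subset hx)
  obtain ⟨K, -, hK, hsK⟩ := T.pure s hs
  have hcard_pos : 0 < s.card := (T.complex.nonempty_of_mem_faces hs).card_pos
  have hcard_le : s.card ≤ 3 := hK ▸ Finset.card_le_card hsK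
  obtain h1 | h2 | h3 : s.card = 1 ∨ s.card = 2 ∨ s.card = 3 := by lia
  · obtain ⟨y, rfl⟩ := Finset.card_eq_one.1 h1
    obtain rfl : x = y := by simpa using hxs.1
    exact absurd hs hvertex
  · exact Or.inr ⟨⟨s, hs, h2⟩, (Edge.cell_eq_openSimplex _).ge hxs⟩
  · exact Or.inl ⟨⟨s, hs, h3⟩, (Element.cell_eq_openSimplex _).ge hxs⟩

namespace DiscreteFunction

variable (u : DiscreteFunction T) {x : Plane}

lemma toFun_of_mem_element_cell {K : T.Element} (hx : x ∈ K.cell) : u.toFun x = u.elem K := by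
  rw [K.cell_eq_openSimplex] at hx
  rw [toFun, Finset.sum_eq_single K, Finset.sum_eq_zero, add_zero,
    indicator_of_mem (K.cell_eq_openSimplex.ge hx)]
  · refine fun e _ => indicator_of_notMem (fun hxe => ?_) _
    rw [e.cell_eq_openSimplex] at hxe
    have hcard := e.2.2
    rw [← eq_of_mem_openSimplex K.2.1 e.2.1 hx hxe, K.2.2] at hcard
    lia
  · refine fun K' _ hne => indicator_of_notMem (fun hxK' => hne ?_) _
    rw [K'.cell_eq_openSimplex] at hxK'
    exact Subtype.ext (eq_of_mem_openSimplex K'.2.1 K.2.1 hxK' hx)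
  · exact fun h => absurd (Finset.mem_univ K) h

lemma toFun_of_mem_edge_cell {e : T.Edge} (hx : x ∈ e.cell) : u.toFun x = u.edge e := by
  rw [e.cell_eq_openSimplex] at hx
  rw [toFun, Finset.sum_eq_zero, zero_add, Finset.sum_eq_single e,
    indicator_of_mem (e.cell_eq_openSimplex.ge hx)]
  · refine fun e' _ hne => indicator_of_notMem (fun hxe' => hne ?_) _
    rw [e'.cell_eq_openSimplex] at hxe'
    exact Subtype.ext (eq_of_mem_openSimplex e'.2.1 e.2.1 hxe' hx)
  · exact fun h => absurd (Finset.mem_univ e) h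
  · refine fun K _ => indicator_of_notMem (fun hxK => ?_) _
    rw [K.cell_eq_openSimplex] at hxK
    have hcard := e.2.2
    rw [← eq_of_mem_openSimplex K.2.1 e.2.1 hxK hx, K.2.2] at hcard
    lia

end DiscreteFunction

namespace TriangularMesh

lemma Edge.exists_mem_cell_of_not_isBoundary {e : T.Edge} (he : ¬ e.IsBoundary) :
    ∃ z ∈ Ω, z ∈ e.cell := by
  obtain ⟨x, hxe, hx⟩ := not_subset.1 he
  obtain ⟨K, hK, hcard, heK⟩ := T.pure e.1 e.2.1
  have hxcl : x ∈ closure Ω :=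
    Element.closedCell_subset_closure_domain ⟨K, hK, hcard⟩ (convexHull_mono heK hxe)
  have hxΩ : x ∈ Ω := by
    by_contra h
    exact hx ⟨hxcl, by rwa [T.isOpen_domain.interior_eq]⟩
  obtain ⟨p, q, hpq, hpe⟩ := Finset.card_eq_two.1 e.2.2
  have hseg : e.closedCell = segment ℝ p q := by
    rw [Edge.closedCell, hpe, Finset.coe_pair, convexHull_pair]
  rw [hseg, ← closure_openSegment] at hxe
  obtain ⟨z, hzΩ, hz⟩ := mem_closure_iff.1 hxe Ω T.isOpen_domain hxΩ
  refine ⟨z, hzΩ, hseg ▸ openSegment_subset_segment ℝ p q hz, ?_⟩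
  rw [hpe, Finset.coe_pair]
  rintro (rfl | rfl)
  · exact hpq (left_mem_openSegment_iff.1 hz)
  · exact hpq (right_mem_openSegment_iff.1 hz)

lemma Edge.exists_element_add_smul_mem {e : T.Edge} {z : Plane} (hzΩ : z ∈ Ω) (hz : z ∈ e.cell)
    (d : Plane) : ∃ K : T.Element, e.1 ⊆ K.1 ∧ ∃ t : ℝ, 0 < t ∧ z + t • d ∈ K.closedCell := by
  have hlim : Filter.Tendsto (fun t : ℝ => z + t • d) (nhdsWithin 0 (Ioi 0)) (nhds z) := by
    have hcont : Continuous fun t : ℝ => z + t • d := by fun_prop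
    simpa using (hcont.tendsto 0).mono_left nhdsWithin_le_nhds
  have havoid : ∀ᶠ y in nhds z, ∀ K : T.Element, z ∉ K.closedCell → y ∉ K.closedCell :=
    Filter.eventually_all.2 fun K => Filter.eventually_imp_distrib_left.2 fun hzK =>
      (Element.isCompact K).isClosed.isOpen_compl.mem_nhds hzK
  obtain ⟨t, ⟨htΩ, htK⟩, ht⟩ := ((hlim.eventually
    ((T.isOpen_domain.eventually_mem hzΩ).and havoid)).and self_mem_nhdsWithin).exists
  obtain ⟨K, hK⟩ := T.exists_element_mem_closedCell htΩ
  have hzK : z ∈ K.closedCell := by_contra fun h => htK K h hK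
  rw [e.cell_eq_openSimplex] at hz
  exact ⟨K, subset_of_mem_openSimplex e.2.1 K.2.1 hz hzK, t, ht, hK⟩

lemma Edge.isBoundary_of_forall_cross_nonneg {e : T.Edge} {p q : Plane} (he : e.1 = {p, q})
    (h : ∀ K : T.Element, e.1 ⊆ K.1 → ∀ x ∈ K.1, 0 ≤ cross (q - p) (x - p)) : e.IsBoundary := by
  by_contra hb
  have hpq : p ≠ q := fun hpq => by simpa [he, hpq] using e.2.2
  obtain ⟨z, hzΩ, hz⟩ := Edge.exists_mem_cell_of_not_isBoundary hb
  obtain ⟨K, heK, t, ht, hK⟩ := Edge.exists_element_add_smul_mem hzΩ hz (rot (q - p))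
  have hzline : cross (q - p) (z - p) = 0 := by
    have hseg := hz.1
    rw [Edge.closedCell, he, Finset.coe_pair, convexHull_pair, segment_eq_image'] at hseg
    obtain ⟨θ, -, rfl⟩ := hseg
    simp [cross_smul_right]
  have hhalf : K.closedCell ⊆ {x | 0 ≤ cross (q - p) (x - p)} := by
    refine convexHull_min (h K heK) ?_
    simp only [cross_sub_right, sub_nonneg]
    exact convex_halfSpace_ge (f := cross (q - p))
      ⟨cross_add_right _, fun r => cross_smul_right r _⟩ _
  have hside : 0 ≤ cross (q - p) (z + t • rot (q - p) - p) := hhalf hK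
  rw [add_sub_right_comm, cross_add_right, hzline, cross_smul_right, cross_rot_self] at hside
  nlinarith [pow_pos (norm_pos_iff.2 (sub_ne_zero.2 hpq.symm)) 2]

lemma exists_supporting_edge {S : Set T.Element} (hS : S.Nonempty) :
    ∃ p q, p ≠ q ∧ (∃ K ∈ S, p ∈ K.1 ∧ q ∈ K.1) ∧
      ∀ K ∈ S, p ∈ K.1 → ∀ x ∈ K.1, 0 ≤ cross (q - p) (x - p) := by
  let V : Set Plane := ⋃ K ∈ S, (K.1 : Set Plane)
  have hVfin : V.Finite := S.toFinite.biUnion fun K _ => K.1.finite_toSet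
  have hVne : V.Nonempty := by
    obtain ⟨K, hK⟩ := hS
    exact ⟨K.basis 0, mem_biUnion hK (K.basis_mem 0)⟩
  obtain ⟨p, hpV, n, hn⟩ := exists_forall_inner_sub_pos hVfin hVne
  obtain ⟨K₀, hK₀, hpK₀⟩ := mem_iUnion₂.1 hpV
  let N : Set Plane := {x | x ≠ p ∧ ∃ K ∈ S, p ∈ K.1 ∧ x ∈ K.1}
  have hNV : N ⊆ V := fun x ⟨_, K, hK, _, hx⟩ => mem_biUnion hK hx
  have hNne : N.Nonempty := by
    obtain ⟨x, hx, hxp⟩ := Finset.exists_mem_ne (K₀.2.2.symm ▸ by norm_num : 1 < K₀.1.card) p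
    exact ⟨x, hxp, K₀, hK₀, hpK₀, hx⟩
  obtain ⟨q, ⟨hqp, hqK⟩, hcross⟩ := exists_forall_cross_nonneg (hVfin.subset hNV) hNne
    (v := fun x => x - p) fun x hx => hn x (hNV hx) hx.1
  refine ⟨p, q, hqp.symm, hqK, fun K hK hpK x hx => ?_⟩
  rcases eq_or_ne x p with rfl | hne
  · simp
  · exact hcross x ⟨hne, K, hK, hpK, hx⟩

theorem exists_isBoundary_edge_eq {α : Type*} {w : T.Edge → α}
    (hw : ∀ (K : T.Element) i j, w (K.edge i) = w (K.edge j)) (e : T.Edge) :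
    ∃ e' : T.Edge, e'.IsBoundary ∧ w e' = w e := by
  have hconst : ∀ {K : T.Element} {e₁ e₂ : T.Edge}, e₁.1 ⊆ K.1 → e₂.1 ⊆ K.1 → w e₁ = w e₂ := by
    intro K e₁ e₂ h₁ h₂
    obtain ⟨i, rfl⟩ := K.exists_edge_eq h₁
    obtain ⟨j, rfl⟩ := K.exists_edge_eq h₂
    exact hw K i j
  let S : Set T.Element := {K | ∀ e' : T.Edge, e'.1 ⊆ K.1 → w e' = w e}
  have hS : S.Nonempty := by
    obtain ⟨K, hK, hcard, heK⟩ := T.pure e.1 e.2.1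
    exact ⟨⟨K, hK, hcard⟩, fun e' he' => hconst he' heK⟩
  obtain ⟨p, q, hpq, ⟨K, hK, hpK, hqK⟩, hside⟩ := exists_supporting_edge hS
  have hsub : {p, q} ⊆ K.1 := Finset.insert_subset hpK (Finset.singleton_subset_iff.2 hqK)
  let e' : T.Edge :=
    ⟨{p, q}, T.complex.down_closed K.2.1 hsub (Finset.insert_nonempty _ _), Finset.card_pair hpq⟩
  have he' : w e' = w e := hK e' hsub
  refine ⟨e', Edge.isBoundary_of_forall_cross_nonneg rfl fun K' hK' => ?_, he'⟩
  exact hside K' (fun e'' he'' => (hconst he'' hK').trans he')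
    (hK' (Finset.mem_insert_self p {q}))

end TriangularMesh

end Mesh

section MaximumPrinciple

variable {Ω : Set Plane} {T : TriangularMesh Ω} {A : Plane → Matrix (Fin 2) (Fin 2) ℝ}

lemma isDiffusionOn_lambdaMin {K : T.Element} {c L : ℝ} (hsymm : ∀ x ∈ K.cell, (A x).IsSymm)
    (hc : 0 < c) (helliptic : ∀ x ∈ K.cell, IsElliptic c (A x))
    (hLip : ∀ x ∈ K.cell, ∀ y ∈ K.cell, ‖A x - A y‖ ≤ L * ‖x - y‖) :
    IsDiffusionOn A K.cell (lambdaMin A K) L := by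
  have hle (x : K.cell) : c ≤ sInf (spectrum ℝ (A x)) :=
    (isElliptic_iff_le_sInf_spectrum (hsymm x x.2)).1 (helliptic x x.2)
  have : Nonempty K.cell := (Element.cell_nonempty K).to_subtype
  exact ⟨hsymm, hc.trans_le (le_ciInf hle), fun x hx =>
    (isElliptic_iff_le_sInf_spectrum (hsymm x hx)).2
      (ciInf_le ⟨c, forall_mem_range.2 hle⟩ (⟨x, hx⟩ : K.cell)), hLip⟩

/-- The function of `V_h` whose edge values are the positive parts `(u_b - M)⁺`: the test function
for the maximum principle. -/
def DiscreteFunction.excess (u : DiscreteFunction T) (M : ℝ) : DiscreteFunction T :=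
  ⟨0, fun e => (u.edge e - M)⁺⟩

lemma IsDiffusionOn.mul_norm_sq_grad_excess_le {K : T.Element} {c L : ℝ}
    (h : IsDiffusionOn A K.cell c L)
    (hschur : ∀ i j, i ≠ j → matForm (K.schur A) (K.normal i) (K.normal j) ≤ 0)
    (u : DiscreteFunction T) (M : ℝ) :
    c * (K.area * ‖(u.excess M).grad K‖ ^ 2) ≤
      matForm (K.schur A) ((u.excess M).grad K) (u.grad K) := by
  have hshift : ∑ i, u.edge (K.edge i) • K.normal i =
      ∑ i, (u.edge (K.edge i) - M) • K.normal i := by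
    simp only [sub_smul, Finset.sum_sub_distrib, ← Finset.smul_sum, K.sum_normal, smul_zero,
      sub_zero]
  refine (h.matForm_schur_self_ge _).trans ?_
  simp only [DiscreteFunction.grad, DiscreteFunction.excess, hshift, ← matBilin_apply, map_smul,
    LinearMap.smul_apply, smul_eq_mul]
  have harea := K.area_pos
  gcongr
  exact apply_sum_posPart_self_le (matBilin (K.schur A)) hschur _

namespace IsWeakGalerkinSolution

variable {f : Plane → ℝ} {g : {e : T.Edge // e.IsBoundary} → ℝ} {u : DiscreteFunction T}
  {c L : T.Element → ℝ}

lemma grad_excess_eq_zero (hu : IsWeakGalerkinSolution T A f g u)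
    (hA : ∀ K : T.Element, IsDiffusionOn A K.cell (c K) (L K))
    (hschur : ∀ (K : T.Element) i j, i ≠ j →
      matForm (K.schur A) (K.normal i) (K.normal j) ≤ 0)
    (hweight : ∀ (K : T.Element) i, 0 ≤ K.weight A i)
    (hf : ∀ K : T.Element, ∫ x in K.cell, f x ≤ 0) {M : ℝ}
    (hM : ∀ e : T.Edge, e.IsBoundary → u.edge e ≤ M) (K : T.Element) :
    (u.excess M).grad K = 0 := by
  have hboundary (e : T.Edge) (he : e.IsBoundary) : (u.excess M).edge e = 0 :=
    posPart_eq_zero.2 (sub_nonpos.2 (hM e he))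
  have hnonneg (K : T.Element) : 0 ≤ c K * (K.area * ‖(u.excess M).grad K‖ ^ 2) :=
    mul_nonneg (hA K).pos.le (mul_nonneg K.area_pos.le (sq_nonneg _))
  have hsum : ∑ K : T.Element, c K * (K.area * ‖(u.excess M).grad K‖ ^ 2) ≤ 0 :=
    calc _ ≤ ∑ K, matForm (TriangularMesh.Element.schur K A) ((u.excess M).grad K) (u.grad K) :=
          Finset.sum_le_sum fun K _ => (hA K).mul_norm_sq_grad_excess_le (hschur K) u M
      _ = ∑ K : T.Element, (∑ i, (u.excess M).edge (K.edge i) * K.weight A i) *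
            ∫ x in K.cell, f x := hu.sum_matForm_schur hA hboundary
      _ ≤ 0 := Finset.sum_nonpos fun K _ => mul_nonpos_of_nonneg_of_nonpos
          (Finset.sum_nonneg fun i _ => mul_nonneg (posPart_nonneg _) (hweight K i)) (hf K)
  have hzero := (Finset.sum_eq_zero_iff_of_nonneg fun K _ => hnonneg K).1
    (hsum.antisymm (Finset.sum_nonneg fun K _ => hnonneg K)) K (Finset.mem_univ K)
  simpa [(hA K).pos.ne', K.area_pos.ne'] using hzero

theorem exists_isBoundary_edge_le (hu : IsWeakGalerkinSolution T A f g u)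
    (hA : ∀ K : T.Element, IsDiffusionOn A K.cell (c K) (L K))
    (hschur : ∀ (K : T.Element) i j, i ≠ j →
      matForm (K.schur A) (K.normal i) (K.normal j) ≤ 0)
    (hweight : ∀ (K : T.Element) i, 0 ≤ K.weight A i)
    (hf : ∀ K : T.Element, ∫ x in K.cell, f x ≤ 0) (e : T.Edge) :
    ∃ e' : T.Edge, e'.IsBoundary ∧ u.edge e ≤ u.edge e' := by
  obtain ⟨e₀, he₀, -⟩ :=
    TriangularMesh.exists_isBoundary_edge_eq (w := fun _ : T.Edge => ()) (fun _ _ _ => rfl) e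
  obtain ⟨e', he', hmax⟩ :=
    exists_max_image {e : T.Edge | e.IsBoundary} u.edge (toFinite _) ⟨e₀, he₀⟩
  obtain ⟨e'', he'', heq⟩ :=
    TriangularMesh.exists_isBoundary_edge_eq (w := (u.excess (u.edge e')).edge)
    (fun K => (u.excess (u.edge e')).edge_eq_of_grad_eq_zero K
      (hu.grad_excess_eq_zero hA hschur hweight hf hmax K)) e
  have hzero : (u.excess (u.edge e')).edge e = 0 :=
    heq.symm.trans (posPart_eq_zero.2 (sub_nonpos.2 (hmax e'' he'')))
  exact ⟨e', he', sub_nonpos.1 (posPart_eq_zero.1 hzero)⟩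

lemma exists_elem_le_edge (hu : IsWeakGalerkinSolution T A f g u)
    (hA : ∀ K : T.Element, IsDiffusionOn A K.cell (c K) (L K)) {K : T.Element}
    (hweight : ∀ i, 0 ≤ K.weight A i) (hf : ∫ x in K.cell, f x ≤ 0) :
    ∃ i, u.elem K ≤ u.edge (K.edge i) := by
  obtain ⟨k, hk⟩ := Finite.exists_max fun i => u.edge (K.edge i)
  refine ⟨k, ?_⟩
  have henergy := (hA K).energy_pos
  calc u.elem K ≤ ∑ i, u.edge (K.edge i) * K.weight A i := by
        rw [hu.elem_eq hA K]
        exact add_le_of_nonpos_right (mul_nonpos_of_nonneg_of_nonpos (by positivity) hf)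
    _ ≤ ∑ i, u.edge (K.edge k) * K.weight A i :=
        Finset.sum_le_sum fun i _ => mul_le_mul_of_nonneg_right (hk i) (hweight i)
    _ = u.edge (K.edge k) := by rw [← Finset.mul_sum, K.sum_weight, mul_one]

theorem exists_isBoundary_toFun_le (hu : IsWeakGalerkinSolution T A f g u)
    (hA : ∀ K : T.Element, IsDiffusionOn A K.cell (c K) (L K))
    (hschur : ∀ (K : T.Element) i j, i ≠ j →
      matForm (K.schur A) (K.normal i) (K.normal j) ≤ 0)
    (hweight : ∀ (K : T.Element) i, 0 ≤ K.weight A i)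
    (hf : ∀ K : T.Element, ∫ x in K.cell, f x ≤ 0) {x : Plane} (hx : x ∈ Ω)
    (hvertex : x ∉ T.complex.vertices) :
    ∃ e : T.Edge, e.IsBoundary ∧ u.toFun x ≤ u.edge e := by
  have hedge := hu.exists_isBoundary_edge_le hA hschur hweight hf
  obtain ⟨K, hK⟩ | ⟨e, he⟩ := T.exists_mem_cell hx hvertex
  · obtain ⟨i, hi⟩ := hu.exists_elem_le_edge hA (hweight K) (hf K)
    obtain ⟨e, he, hle⟩ := hedge (K.edge i)
    exact ⟨e, he, (u.toFun_of_mem_element_cell hK).trans_le (hi.trans hle)⟩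
  · obtain ⟨e', he', hle⟩ := hedge e
    exact ⟨e', he', (u.toFun_of_mem_edge_cell he).trans_le hle⟩

end IsWeakGalerkinSolution

end MaximumPrinciple

end WeakGalerkin

end

theorem mainTheorem4_general (Ω : Set WeakGalerkin.Plane) (T : WeakGalerkin.TriangularMesh Ω)
    (A : WeakGalerkin.Plane → Matrix (Fin 2) (Fin 2) ℝ)
    (hAsymm : ∀ x ∈ Ω, (A x).IsSymm)
    (hApos : ∃ c : ℝ, 0 < c ∧ ∀ x ∈ Ω, ∀ ξ : WeakGalerkin.Plane,
      c * ‖ξ‖ ^ 2 ≤ WeakGalerkin.matForm (A x) ξ ξ)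
    (L : T.Element → ℝ)
    (hLip : ∀ K : T.Element, ∀ x ∈ K.cell, ∀ y ∈ K.cell, ‖A x - A y‖ ≤ L K * ‖x - y‖)
    (hangle : ∀ K : T.Element, ∀ p ∈ K.1, ∀ q ∈ K.1, ∀ r ∈ K.1, p ≠ q → p ≠ r → q ≠ r →
      L K ^ 2 * K.diam ^ 2 / WeakGalerkin.lambdaMin A K ^ 2 ≤
        WeakGalerkin.cosAngle (WeakGalerkin.average A K)⁻¹ p q r)
    (hshape : ∀ K : T.Element, 0 < L K →
      K.diam ^ 3 / K.area ≤ 2 * WeakGalerkin.lambdaMin A K / (3 * L K))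
    (f : WeakGalerkin.Plane → ℝ) (_hf : IntegrableOn f Ω)
    (g : {e : T.Edge // e.IsBoundary} → ℝ) (u : WeakGalerkin.DiscreteFunction T)
    (hu : WeakGalerkin.IsWeakGalerkinSolution T A f g u)
    (hf_nonpos : ∀ K : T.Element, ∫ x in K.cell, f x ≤ 0) :
    ∀ x ∈ Ω, x ∉ T.complex.vertices →
      ∃ e : {e : T.Edge // e.IsBoundary}, u.toFun x ≤ u.edge e.1 := by
  intro x hx hvertex
  obtain ⟨c, hc, helliptic⟩ := hApos
  have hA (K : T.Element) :
      WeakGalerkin.IsDiffusionOn A K.cell (WeakGalerkin.lambdaMin A K) (L K) :=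
    WeakGalerkin.isDiffusionOn_lambdaMin (fun x hx => hAsymm x (K.cell_subset_domain hx)) hc
      (fun x hx => helliptic x (K.cell_subset_domain hx)) (hLip K)
  obtain ⟨e, he, hle⟩ := hu.exists_isBoundary_toFun_le hA
    (fun K _ _ => (hA K).schur_normal_nonpos (hangle K))
    (fun K => (hA K).weight_nonneg (hshape K)) hf_nonpos hx hvertex
  exact ⟨⟨e, he⟩, hle⟩

theorem mainTheorem4 (Ω : Set WeakGalerkin.Plane) (T : WeakGalerkin.TriangularMesh Ω)
    (A : WeakGalerkin.Plane → Matrix (Fin 2) (Fin 2) ℝ)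
    (hAsymm : ∀ x ∈ Ω, (A x).IsSymm)
    (hApos : ∃ c : ℝ, 0 < c ∧ ∀ x ∈ Ω, ∀ ξ : WeakGalerkin.Plane,
      c * ‖ξ‖ ^ 2 ≤ WeakGalerkin.matForm (A x) ξ ξ)
    (L : T.Element → ℝ)
    -- here the matrix norm is the operator norm induced by the Euclidean norm
    (hLip : ∀ K : T.Element, ∀ x ∈ K.cell, ∀ y ∈ K.cell, ‖A x - A y‖ ≤ L K * ‖x - y‖)
    (hangle : ∀ K : T.Element, ∀ p ∈ K.1, ∀ q ∈ K.1, ∀ r ∈ K.1, p ≠ q → p ≠ r → q ≠ r →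
      L K ^ 2 * K.diam ^ 2 / WeakGalerkin.lambdaMin A K ^ 2 ≤
        WeakGalerkin.cosAngle (WeakGalerkin.average A K)⁻¹ p q r)
    -- for `L K = 0` the right-hand side is `∞`, and the condition is void
    (hshape : ∀ K : T.Element, 0 < L K →
      K.diam ^ 3 / K.area ≤ 2 * WeakGalerkin.lambdaMin A K / (3 * L K))
    (f : WeakGalerkin.Plane → ℝ) (hf : IntegrableOn f Ω)
    (g : {e : T.Edge // e.IsBoundary} → ℝ) (u : WeakGalerkin.DiscreteFunction T)
    (hu : WeakGalerkin.IsWeakGalerkinSolution T A f g u) :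
    (∀ x ∈ Ω, f x ≤ 0) →
      ∀ x ∈ Ω, x ∉ T.complex.vertices →
        u.toFun x ≤ max 0 (⨆ e : {e : T.Edge // e.IsBoundary}, u.edge e.1) := by
  intro hf_nonpos x hx hvertex
  obtain ⟨e, he⟩ := mainTheorem4_general Ω T A hAsymm hApos L hLip hangle hshape f hf g u hu
    (fun K => setIntegral_nonpos isOpen_interior.measurableSet fun y hy =>
      hf_nonpos y (K.cell_subset_domain hy)) x hx hvertex
  exact he.trans ((le_ciSup (finite_range fun e : {e : T.Edge // e.IsBoundary} =>
    u.edge e.1).bddAbove e).trans (le_max_right _ _))
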